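/- Let $\mathcal X,\mathcal Y$ be finite-dimensional Euclidean spaces, let $\mathcal S^n$ be the space of real symmetric $n\times n$ matrices with the Frobenius inner product, $\mathcal S^n_+$ (resp. $\mathcal S^n_-$) the cone of positive (resp. negative) semidefinite matrices, and let products of these spaces carry the Euclidean product norm. Let $f:\mathcal X\to\mathbb R$, $h:\mathcal X\to\mathcal Y$, $G:\mathcal X\to\mathcal S^n$ be twice continuously differentiable, and consider the problem $$\min_{x\in\mathcal X} f(x)\quad\text{s.t. } h(x)=0,\ G(x)\in\mathcal S^n_+ ,$$ with Lagrangian $L(x,y,\Gamma)=f(x)+\langle y,h(x)\rangle+\langle\Gamma,G(x)\rangle$. For $(a_1,a_2,b)\in\mathcal X\times\mathcal Y\times\mathcal S^n$ let $$S_{\rm KKT}(a_1,a_2,b)=\{(x,y,\Gamma):\ \nabla_xL(x,y,\Gamma)-a_1=0,\ h(x)-a_2=0,\ \mathcal S^n_+\ni (G(x)-b)\perp\Gamma\in\mathcal S^n_-\},$$ and let $\mathcal M(x)=\{(y,\Gamma): (x,y,\Gamma)\in S_{\rm KKT}(0,0,0)\}$; $x$ is called stationary if $\mathcal M(x)\neq\emptyset$.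 For $X\in\mathcal S^n_+$ let $N_{\mathcal S^n_+}(X)$ be the normal cone of convex analysis and $T_{\mathcal S^n_+}(X)$ the Bouligand tangent cone. Put $$\mathcal G_1(x)=\{(y,\Gamma):\nabla f(x)+\nabla h(x)^*y+\nabla G(x)^*\Gamma=0\},\qquad \mathcal G_2(x)=\{(y,\Gamma):\Gamma\in N_{\mathcal S^n_+}(G(x))\}.$$ Let $\bar x$ be a stationary point and $(\bar y,\bar\Gamma)\in\mathcal M(\bar x)$. Assume: (i) the second-order sufficient condition (SOSC) holds at $(\bar x,\bar y,\bar\Gamma)$: for every $d\neq0$ in the critical cone $$\mathcal C(\bar x)=\{d\in\mathcal X:\ \nabla h(\bar x)d=0,\ \nabla G(\bar x)d\in T_{\mathcal S^n_+}(G(\bar x))\cap\bar\Gamma^{\perp}\}$$ one has $$\langle\nabla^2_{xx}L(\bar x,\bar y,\bar\Gamma)d,d\rangle-2\big\langle\bar\Gamma,(\nabla G(\bar x)d)\,G(\bar x)^{\dagger}\,(\nabla G(\bar x)d)\big\rangle>0,$$ where $G(\bar x)^\dagger$ is the Moore–Penrose inverse of $G(\bar x)$; (ii) $\mathcal G_1(\bar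 x)\cap\mathrm{ri}\,\mathcal G_2(\bar x)\neq\emptyset$, where $\mathrm{ri}$ denotes the relative interior. Then $S_{\rm KKT}$ is semi-isolatedly calm at $((0,0,0),(\bar x,\bar y,\bar\Gamma))$: there exist $\kappa_1>0$, $r_1>0$ and an open neighborhood $\mathbb U$ of $(0,0,0)$ such that for all $(a_1,a_2,b)\in\mathbb U$ and all $(x,y,\Gamma)\in S_{\rm KKT}(a_1,a_2,b)$ in the ball of radius $r_1$ centered at $(\bar x,\bar y,\bar\Gamma)$, $$\|x-\bar x\|+\mathrm{dist}\big((y,\Gamma),\mathcal M(\bar x)\big)\le\kappa_1\|(a_1,a_2,b)\|.$$ -/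

import Mathlib

open Filter Topology

noncomputable section

namespace NLSDP

/-! ### Symmetric matrices with the Frobenius inner product -/

/-- The symmetric `n × n` real matrices, as a subspace of the Euclidean space of all families
`(a (i, j))`; the inherited inner product is the Frobenius one (see `inner_eq_trace`). -/
def symSubmodule (n : ℕ) : Submodule ℝ (EuclideanSpace ℝ (Fin n × Fin n)) where
  carrier := {a | ∀ i j, a (i, j) = a (j, i)}
  add_mem' := by
    intro a b ha hb i j
    simp [ha i j, hb i j]
  zero_mem' := by
    intro i j
    simp
  smul_mem' := by
    intro c a ha i j
    simp [ha i j]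

/-- The Euclidean space `𝓢ⁿ` of symmetric `n × n` real matrices. -/
abbrev SymMat (n : ℕ) : Type := ↥(symSubmodule n)

/-- The underlying matrix of an element of `𝓢ⁿ`. -/
def SymMat.mat {n : ℕ} (A : SymMat n) : Matrix (Fin n) (Fin n) ℝ :=
  Matrix.of fun i j => (A : EuclideanSpace ℝ (Fin n × Fin n)) (i, j)

/-- The element of `𝓢ⁿ` given by a symmetric matrix. -/
def SymMat.ofMat {n : ℕ} (M : Matrix (Fin n) (Fin n) ℝ) (hM : M.IsSymm) : SymMat n :=
  ⟨WithLp.toLp 2 fun p => M p.1 p.2, fun i j => by simpa using hM.apply j i⟩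

theorem SymMat.mat_ofMat {n : ℕ} (M : Matrix (Fin n) (Fin n) ℝ) (hM : M.IsSymm) :
    (SymMat.ofMat M hM).mat = M := rfl

theorem SymMat.isHermitian {n : ℕ} (A : SymMat n) : A.mat.IsHermitian := by
  ext i j
  simpa [SymMat.mat, Matrix.conjTranspose_apply] using A.2 j i

theorem SymMat.inner_eq_trace {n : ℕ} (A B : SymMat n) :
    inner ℝ A B = (A.mat * B.mat).trace := by
  rw [Submodule.coe_inner, PiLp.inner_apply, Fintype.sum_prod_type]
  simp only [Matrix.trace, Matrix.diag, Matrix.mul_apply]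
  refine Finset.sum_congr rfl fun i _ => Finset.sum_congr rfl fun j _ => ?_
  simp only [SymMat.mat, Matrix.of_apply]
  rw [B.2 j i]
  simp [mul_comm]

/-- The generalized (Moore–Penrose) inverse `X†` of a symmetric matrix `X = P Diag(λ) Pᵀ`, namely
`P Diag(λ†) Pᵀ` with `λ† = 1/λ` for `λ ≠ 0` and `0† = 0`; see `SymMat.penrose`. -/
def SymMat.pinv {n : ℕ} (X : SymMat n) : Matrix (Fin n) (Fin n) ℝ :=
  X.isHermitian.eigenvectorUnitary.1 *
    Matrix.diagonal (fun i => (X.isHermitian.eigenvalues i)⁻¹) *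
    star X.isHermitian.eigenvectorUnitary.1

/-- The four Penrose equations, which characterize the generalized inverse. -/
theorem SymMat.penrose {n : ℕ} (X : SymMat n) :
    X.mat * X.pinv * X.mat = X.mat ∧ X.pinv * X.mat * X.pinv = X.pinv ∧
      (X.mat * X.pinv).IsSymm ∧ (X.pinv * X.mat).IsSymm := by
  set U : Matrix (Fin n) (Fin n) ℝ := X.isHermitian.eigenvectorUnitary.1 with hU
  set l := X.isHermitian.eigenvalues with hl
  have hUU : star U * U = 1 := Unitary.coe_star_mul_self _
  have hX : X.mat = U * Matrix.diagonal l * star U := by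
    have := X.isHermitian.spectral_theorem
    rw [Unitary.conjStarAlgAut_apply] at this
    exact this
  have hP : X.pinv = U * Matrix.diagonal (fun i => (l i)⁻¹) * star U := rfl
  have key : ∀ D E : Matrix (Fin n) (Fin n) ℝ,
      (U * D * star U) * (U * E * star U) = U * (D * E) * star U := by
    intro D E
    calc (U * D * star U) * (U * E * star U) = U * D * (star U * U) * E * star U := by
          simp only [Matrix.mul_assoc]
      _ = U * (D * E) * star U := by rw [hUU]; simp [Matrix.mul_assoc]
  have sym : ∀ d : Fin n → ℝ, (U * Matrix.diagonal d * star U).IsSymm := by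
    intro d
    have : star U = U.transpose := by
      rw [Matrix.star_eq_conjTranspose, Matrix.conjTranspose_eq_transpose_of_trivial]
    rw [this, Matrix.IsSymm]
    rw [Matrix.transpose_mul, Matrix.transpose_mul, Matrix.transpose_transpose,
      Matrix.diagonal_transpose, Matrix.mul_assoc]
  refine ⟨?_, ?_, ?_, ?_⟩
  · rw [hX, hP, key, key, Matrix.diagonal_mul_diagonal, Matrix.diagonal_mul_diagonal]
    simp
  · rw [hX, hP, key, key, Matrix.diagonal_mul_diagonal, Matrix.diagonal_mul_diagonal]
    have : (fun i => (l i)⁻¹ * l i * (l i)⁻¹) = fun i => (l i)⁻¹ := by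
      funext i
      by_cases hi : l i = 0
      · simp [hi]
      · field_simp
    rw [this]
  · rw [hX, hP, key, Matrix.diagonal_mul_diagonal]
    exact sym _
  · rw [hX, hP, key, Matrix.diagonal_mul_diagonal]
    exact sym _

/-- The positive semidefinite cone `𝓢ⁿ₊`. -/
def psdCone (n : ℕ) : Set (SymMat n) := {A | A.mat.PosSemidef}

/-- The negative semidefinite cone `𝓢ⁿ₋`. -/
def nsdCone (n : ℕ) : Set (SymMat n) := {A | -A ∈ psdCone n}

/-! ### Cones of variational analysis -/

section Cones

variable {E : Type*} [NormedAddCommGroup E] [InnerProductSpace ℝ E]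

/-- The normal cone (in the sense of convex analysis) to a convex set `C` at `x`; it is empty for
`x ∉ C`. -/
def normalCone (C : Set E) (x : E) : Set E :=
  {v | x ∈ C ∧ ∀ x' ∈ C, inner ℝ v (x' - x) ≤ 0}

/-- The Bouligand tangent (contingent) cone to `C` at `x`. -/
def tangentCone (C : Set E) (x : E) : Set E :=
  {d | ∃ (t : ℕ → ℝ) (u : ℕ → E), (∀ k, 0 < t k) ∧ Tendsto t atTop (𝓝 0) ∧
    Tendsto u atTop (𝓝 d) ∧ ∀ k, x + t k • u k ∈ C}

/-- The critical cone `T_C(x) ∩ y^⊥`. -/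
def criticalCone (C : Set E) (x y : E) : Set E :=
  {d | d ∈ tangentCone C x ∧ inner ℝ y d = 0}

end Cones

/-! ### The problem: minimize `f x` subject to `h x = 0`, `G x ∈ 𝓢ⁿ₊` -/

/-- The Euclidean space `𝓨 × 𝓢ⁿ` of multipliers `(y, Γ)`. -/
abbrev Mult (Y : Type*) (n : ℕ) : Type _ := WithLp 2 (Y × SymMat n)

/-- The Euclidean space `𝓧 × 𝓨 × 𝓢ⁿ` of triples. -/
abbrev Triple (X Y : Type*) (n : ℕ) : Type _ := WithLp 2 (X × Mult Y n)

/-- The triple `(x, y, Γ)` as an element of `𝓧 × 𝓨 × 𝓢ⁿ`. -/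
def triple {X Y : Type*} {n : ℕ} (x : X) (y : Y) (Γ : SymMat n) : Triple X Y n :=
  WithLp.toLp 2 (x, WithLp.toLp 2 (y, Γ))

section Problem

variable {X : Type*} [NormedAddCommGroup X] [InnerProductSpace ℝ X] [CompleteSpace X]
  {Y : Type*} [NormedAddCommGroup Y] [InnerProductSpace ℝ Y] [CompleteSpace Y] {n : ℕ}

/-- The Lagrangian `L(x, y, Γ) = f(x) + ⟨y, h(x)⟩ + ⟨Γ, G(x)⟩`. -/
def lagrangian (f : X → ℝ) (h : X → Y) (G : X → SymMat n) (x : X) (y : Y) (Γ : SymMat n) : ℝ :=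
  f x + inner ℝ y (h x) + inner ℝ Γ (G x)

/-- The gradient `∇ₓL(x, y, Γ)`. -/
def gradLagrangian (f : X → ℝ) (h : X → Y) (G : X → SymMat n)
    (x : X) (y : Y) (Γ : SymMat n) : X :=
  gradient (fun x' => lagrangian f h G x' y Γ) x

/-- The Hessian `∇²ₓₓL(x, y, Γ)`, a linear operator on `𝓧`. -/
def hessLagrangian (f : X → ℝ) (h : X → Y) (G : X → SymMat n)
    (x : X) (y : Y) (Γ : SymMat n) : X →L[ℝ] X :=
  fderiv ℝ (fun x' => gradLagrangian f h G x' y Γ) x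

/-- The KKT solution map `S_KKT(a₁, a₂, b)` of the perturbed problem: minimize `f x - ⟨a₁, x⟩`
subject to `h x - a₂ = 0`, `G x - b ∈ 𝓢ⁿ₊`. -/
def kktSol (f : X → ℝ) (h : X → Y) (G : X → SymMat n)
    (a₁ : X) (a₂ : Y) (b : SymMat n) : Set (Triple X Y n) :=
  {z | ∃ (x : X) (y : Y) (Γ : SymMat n), z = triple x y Γ ∧
    gradLagrangian f h G x y Γ - a₁ = 0 ∧ h x - a₂ = 0 ∧
    G x - b ∈ psdCone n ∧ inner ℝ (G x - b) Γ = 0 ∧ Γ ∈ nsdCone n}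

/-- The set `𝓜(x)` of multipliers `(y, Γ)` such that `(x, y, Γ) ∈ S_KKT(0, 0, 0)`. -/
def multipliers (f : X → ℝ) (h : X → Y) (G : X → SymMat n) (x : X) : Set (Mult Y n) :=
  {l | triple x l.fst l.snd ∈ kktSol f h G 0 0 0}

/-- `x` is a stationary point of the unperturbed problem. -/
def IsStationary (f : X → ℝ) (h : X → Y) (G : X → SymMat n) (x : X) : Prop :=
  ∃ (y : Y) (Γ : SymMat n), triple x y Γ ∈ kktSol f h G 0 0 0

/-- The critical cone of the problem at `x` (for the multiplier component `Γ`). -/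
def problemCriticalCone (h : X → Y) (G : X → SymMat n) (x : X) (Γ : SymMat n) : Set X :=
  {d | fderiv ℝ h x d = 0 ∧ fderiv ℝ G x d ∈ criticalCone (psdCone n) (G x) Γ}

/-- The σ-term `Υ_A(Γ, D) = 2⟨Γ, D A† D⟩` (Frobenius inner product). -/
def sigmaTerm (A Γ D : SymMat n) : ℝ :=
  2 * (Γ.mat * (D.mat * A.pinv * D.mat)).trace

/-- The second order sufficient condition at `(x, y, Γ)`. -/
def SOSC (f : X → ℝ) (h : X → Y) (G : X → SymMat n) (x : X) (y : Y) (Γ : SymMat n) : Prop :=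
  ∀ d ∈ problemCriticalCone h G x Γ, d ≠ 0 →
    0 < inner ℝ (hessLagrangian f h G x y Γ d) d - sigmaTerm (G x) Γ (fderiv ℝ G x d)

/-- `𝓖₁(x)`: the `(y, Γ)` with `∇f(x) + ∇h(x)* y + ∇G(x)* Γ = 0`. -/
def multG1 (f : X → ℝ) (h : X → Y) (G : X → SymMat n) (x : X) : Set (Mult Y n) :=
  {l | gradient f x + ContinuousLinearMap.adjoint (fderiv ℝ h x) l.fst +
    ContinuousLinearMap.adjoint (fderiv ℝ G x) l.snd = 0}

/-- `𝓖₂(x)`: the `(y, Γ)` with `Γ ∈ N_{𝓢ⁿ₊}(G(x))`. -/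
def multG2 (Y : Type*) (G : X → SymMat n) (x : X) : Set (Mult Y n) :=
  {l | l.snd ∈ normalCone (psdCone n) (G x)}

end Problem

end NLSDP

end

/-!
Write the constraints as `g x ∈ K` with `g = (h, G)` and `K = {0} × 𝓢ⁿ₊`, and let `l` be the
multiplier of a solution of the KKT system perturbed by `(a, q)`. The normal cone mapping of `K` is
calm at `g x̄`, and the relative interior condition makes the two sets whose intersection is
`𝓜(x̄)`, an affine space and the normal cone at `g x̄`, linearly regular on bounded sets. Together
these bound the distance from `l` to `𝓜(x̄)` by a multiple of `‖x - x̄‖ + ‖a‖ + ‖q‖`, so only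
`‖x - x̄‖ = O(‖a‖ + ‖q‖)` remains.

If this fails, then along some sequence `(x - x̄) / ‖x - x̄‖` tends to a critical direction `d ≠ 0`
and the perturbations are `o(‖x - x̄‖)`. Subtract the KKT system of a nearby multiplier
`m ∈ 𝓜(x̄)` from that of `(x, l)` and pair with `x - x̄`: in the limit, `⟪∇²ₓₓL d, d⟫` plus the
normalized pairing of `l - m` with `g x - q - g x̄` vanishes. The normal cone of `𝓢ⁿ₊` is
monotone with a second-order gain, and by an expansion around `G x̄` in powers of `G(x̄)†` this gain
is exactly the curvature term of the second-order condition, which is thereby contradicted.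
-/

namespace NLSDP

open Asymptotics ContinuousLinearMap

section Regularity

variable {E F : Type*} [NormedAddCommGroup E] [NormedSpace ℝ E] [NormedAddCommGroup F]
  [NormedSpace ℝ F] {S : Set E} {v : E}

theorem exists_mem_preimage_norm_le [FiniteDimensional ℝ F] (T : E →ₗ[ℝ] F)
    (W : Submodule ℝ E) :
    ∃ C : ℝ, 0 < C ∧ ∀ w ∈ W, ∃ u ∈ W, T u = T w ∧ ‖u‖ ≤ C * ‖T w‖ := by
  set R : W →ₗ[ℝ] F := T.comp W.subtype
  obtain ⟨section_R, h_section⟩ :=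
    R.rangeRestrict.exists_rightInverse_of_surjective R.range_rangeRestrict
  obtain ⟨C, hC, hbound⟩ := (LinearMap.toContinuousLinearMap section_R).bound
  refine ⟨C, hC, fun w hw => ?_⟩
  let y := R.rangeRestrict ⟨w, hw⟩
  exact ⟨section_R y, (section_R y).2, congrArg Subtype.val (LinearMap.congr_fun h_section y),
    hbound y⟩

theorem exists_add_mem_of_mem_intrinsicInterior (hv : v ∈ intrinsicInterior ℝ S) :
    ∃ ε : ℝ, 0 < ε ∧ ∀ u ∈ (affineSpan ℝ S).direction, ‖u‖ ≤ ε → v + u ∈ S := by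
  obtain ⟨v, h_interior, rfl⟩ := mem_intrinsicInterior.1 hv
  obtain ⟨ε, hε, hball⟩ :=
    Metric.nhds_basis_closedBall.mem_iff.1 (mem_interior_iff_mem_nhds.1 h_interior)
  refine ⟨ε, hε, fun u hu hun => ?_⟩
  have hspan : (v : E) + u ∈ affineSpan ℝ S := by
    simpa only [vadd_eq_add, add_comm] using AffineSubspace.vadd_mem_of_mem_direction hu v.2
  have hdist : (⟨v + u, hspan⟩ : affineSpan ℝ S) ∈ Metric.closedBall v ε := by
    rwa [Metric.mem_closedBall, Subtype.dist_eq, dist_self_add_left]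
  exact hball hdist

theorem exists_mem_map_sub_eq_neg_smul [FiniteDimensional ℝ F] (T : E →ₗ[ℝ] F)
    (hv : v ∈ intrinsicInterior ℝ S) :
    ∃ δ : ℝ, 0 < δ ∧ ∃ ε : ℝ, 0 < ε ∧ ∀ l ∈ S, T l ≠ T v →
      ∃ p ∈ S, ‖p - v‖ ≤ ε ∧ T p - T v = -(δ / ‖T l - T v‖) • (T l - T v) := by
  obtain ⟨ε, hε, hball⟩ := exists_add_mem_of_mem_intrinsicInterior hv
  obtain ⟨C, hC, hpre⟩ := exists_mem_preimage_norm_le T (affineSpan ℝ S).direction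
  refine ⟨ε / C, by positivity, ε, hε, fun l hl hne => ?_⟩
  obtain ⟨u, hu, hTu, hun⟩ := hpre (l - v) (AffineSubspace.vsub_mem_direction
    (subset_affineSpan ℝ S hl) (subset_affineSpan ℝ S (intrinsicInterior_subset hv)))
  rw [map_sub] at hTu hun
  have hres : 0 < ‖T l - T v‖ := norm_pos_iff.2 (sub_ne_zero.2 hne)
  set ρ := ε / C / ‖T l - T v‖ with hρ
  have hsmall : ‖-ρ • u‖ ≤ ε := calc
    ‖-ρ • u‖ = ρ * ‖u‖ := by rw [norm_smul, norm_neg, Real.norm_of_nonneg (by positivity)]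
    _ ≤ ρ * (C * ‖T l - T v‖) := by gcongr
    _ = ε := by rw [hρ]; field_simp
  refine ⟨v + -ρ • u, hball _ (Submodule.smul_mem _ _ hu) hsmall, ?_, ?_⟩
  · rwa [add_sub_cancel_left]
  · rw [map_add, add_sub_cancel_left, map_smul, hTu]

-- On the segment from `l` to a point of `S` on which the residual has the opposite direction,
-- the residual vanishes after a step of length proportional to `‖T l - T v‖`.
theorem exists_mem_eq_norm_sub_le [FiniteDimensional ℝ F] (T : E →ₗ[ℝ] F) (hS : Convex ℝ S)
    (hv : v ∈ intrinsicInterior ℝ S) :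
    ∃ K : ℝ, ∀ l ∈ S, ∃ m ∈ S, T m = T v ∧ ‖l - m‖ ≤ K * ((1 + ‖l - v‖) * ‖T l - T v‖) := by
  obtain ⟨δ, hδ, ε, hε, hopposite⟩ := exists_mem_map_sub_eq_neg_smul T hv
  refine ⟨δ⁻¹ * (1 + ε), fun l hl => ?_⟩
  by_cases hres : T l = T v
  · exact ⟨l, hl, hres, by simp [hres]⟩
  obtain ⟨p, hp, hpv, hTp⟩ := hopposite l hl hres
  set r := ‖T l - T v‖
  have hr : 0 < r := norm_pos_iff.2 (sub_ne_zero.2 hres)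
  set θ := r / (r + δ) with hθ
  have hθ_compl : 1 - θ = θ * (δ / r) := by rw [hθ]; field_simp; ring
  have hθ_le : θ ≤ δ⁻¹ * r := by rw [hθ, inv_mul_eq_div]; gcongr; linarith
  refine ⟨(1 - θ) • l + θ • p, hS hl hp (by rw [hθ_compl]; positivity) (by positivity) (by ring),
    ?_, ?_⟩
  · rw [map_add, map_smul, map_smul, sub_eq_iff_eq_add.1 hTp, smul_add, smul_smul, mul_neg,
      ← hθ_compl]
    module
  · have hlp : ‖l - p‖ ≤ ‖l - v‖ + ε := by
      rw [← sub_sub_sub_cancel_right l p v]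
      exact (norm_sub_le _ _).trans (by gcongr)
    calc ‖l - ((1 - θ) • l + θ • p)‖ = ‖θ • (l - p)‖ := by congr 1; module
      _ = θ * ‖l - p‖ := by rw [norm_smul, Real.norm_of_nonneg (by positivity)]
      _ ≤ δ⁻¹ * r * ((1 + ε) * (1 + ‖l - v‖)) := by
          gcongr
          nlinarith [mul_nonneg hε.le (norm_nonneg (l - v))]
      _ = δ⁻¹ * (1 + ε) * ((1 + ‖l - v‖) * r) := by ring

theorem exists_mem_eq_sub_isBigO [FiniteDimensional ℝ F] {ι : Type*} {𝓕 : Filter ι} {l : ι → E}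
    (T : E →ₗ[ℝ] F) (hS : Convex ℝ S) (hv : v ∈ intrinsicInterior ℝ S)
    (hl : l =O[𝓕] fun _ => (1 : ℝ)) (hlS : ∀ᶠ i in 𝓕, l i ∈ S) :
    ∃ m : ι → E, (∀ᶠ i in 𝓕, m i ∈ S ∧ T (m i) = T v) ∧
      (fun i => l i - m i) =O[𝓕] fun i => T (l i) - T v := by
  obtain ⟨K, hK⟩ := exists_mem_eq_norm_sub_le T hS hv
  obtain ⟨m, hm⟩ := skolem.1 (hlS.mono fun i hi => hK (l i) hi)
  have hbounded : (fun i => 1 + ‖l i - v‖) =O[𝓕] fun _ => (1 : ℝ) :=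
    (isBigO_refl _ _).add (hl.sub (isBigO_const_const v one_ne_zero 𝓕)).norm_left
  have hresidual : (fun i => (1 + ‖l i - v‖) * ‖T (l i) - T v‖) =O[𝓕] fun i => T (l i) - T v := by
    simpa only [one_mul, isBigO_norm_right] using
      hbounded.mul (isBigO_refl (fun i => ‖T (l i) - T v‖) 𝓕)
  refine ⟨m, hm.mono fun i hi => ⟨hi.1, hi.2.1⟩, (IsBigO.of_bound K ?_).trans hresidual⟩
  filter_upwards [hm] with i hi
  rw [Real.norm_of_nonneg (by positivity)]
  exact hi.2.2

end Regularity

section Asymptotic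

theorem exists_seq_isLittleO_of_not_isBigO {ι E F : Type*} [NormedAddCommGroup E]
    [NormedAddCommGroup F] {𝓕 : Filter ι} [𝓕.IsCountablyGenerated] {u : ι → E} {v : ι → F}
    (h : ¬ u =O[𝓕] v) :
    ∃ s : ℕ → ι, Tendsto s atTop 𝓕 ∧ (∀ k, u (s k) ≠ 0) ∧ (v ∘ s) =o[atTop] (u ∘ s) := by
  obtain ⟨B, hB⟩ := 𝓕.exists_antitone_basis
  have hlarge : ∀ k : ℕ, ∃ i ∈ B k, k * ‖v i‖ < ‖u i‖ := by
    intro k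
    by_contra! hk
    exact h (IsBigO.of_bound k (eventually_of_mem (hB.mem k) hk))
  choose s hsB hs using hlarge
  refine ⟨s, hB.tendsto hsB, fun k => ?_, isLittleO_iff_nat_mul_le.2 fun N => ?_⟩
  · exact norm_pos_iff.1 ((by positivity : (0 : ℝ) ≤ k * ‖v (s k)‖).trans_lt (hs k))
  · filter_upwards [eventually_ge_atTop N] with k hk
    exact (by gcongr : (N : ℝ) * ‖v (s k)‖ ≤ k * ‖v (s k)‖).trans (hs k).le

theorem tendsto_inv_smul_sub_of_hasFDerivAt {ι E F : Type*} [NormedAddCommGroup E] [NormedSpace ℝ E]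
    [NormedAddCommGroup F] [NormedSpace ℝ F] {𝓕 : Filter ι} {φ : E → F} {φ' : E →L[ℝ] F}
    {p d : E} {t : ι → ℝ} {x : ι → E} (hφ : HasFDerivAt φ φ' p) (hx : Tendsto x 𝓕 (𝓝 p))
    (hd : Tendsto (fun i => (t i)⁻¹ • (x i - p)) 𝓕 (𝓝 d)) :
    Tendsto (fun i => (t i)⁻¹ • (φ (x i) - φ p)) 𝓕 (𝓝 (φ' d)) := by
  have hnull : Tendsto (fun i => x i - p) 𝓕 (𝓝 0) := by simpa using hx.sub_const p
  simpa only [add_sub_cancel] using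
    (hasFDerivWithinAt_univ.2 hφ).lim hnull (by simp) hd

theorem tendsto_inner_zero_of_isBigO_one {ι E : Type*} [NormedAddCommGroup E]
    [InnerProductSpace ℝ E] {𝓕 : Filter ι} {u w : ι → E} (hu : u =O[𝓕] fun _ => (1 : ℝ))
    (hw : Tendsto w 𝓕 (𝓝 0)) : Tendsto (fun i => inner ℝ (u i) (w i)) 𝓕 (𝓝 0) := by
  have hprod := hu.norm_left.mul_isLittleO ((isLittleO_one_iff ℝ).2 hw).norm_left
  rw [one_mul, isLittleO_one_iff] at hprod
  exact squeeze_zero_norm (fun i => norm_inner_le_norm (u i) (w i)) hprod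

theorem differentiableAt_adjoint_comp {E F G : Type*} [NormedAddCommGroup E] [NormedSpace ℝ E]
    [NormedAddCommGroup F] [InnerProductSpace ℝ F] [CompleteSpace F] [NormedAddCommGroup G]
    [InnerProductSpace ℝ G] [CompleteSpace G] {u : E → F →L[ℝ] G} {p : E}
    (hu : DifferentiableAt ℝ u p) : DifferentiableAt ℝ (fun x => adjoint (u x)) p := by
  have hadj : IsBoundedLinearMap ℝ (fun T : F →L[ℝ] G => adjoint T) :=
    { map_add := map_add _
      map_smul := fun c T => by simp
      bound := ⟨1, one_pos, fun T => by simp⟩ }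
  exact hadj.differentiableAt.comp p hu

end Asymptotic

section NormalCone

variable {Z : Type*} [NormedAddCommGroup Z] [InnerProductSpace ℝ Z] {K : Set Z}

/-- Calmness at `z` of the normal cone mapping of `K`, in homogeneous form: a normal `l` at `w` is
within a multiple of `‖l‖ * ‖w - z‖` of a normal at `z`. -/
def IsNormalConeCalm (K : Set Z) (z : Z) : Prop :=
  ∃ C : ℝ, ∀ w, ∀ l ∈ normalCone K w, ∃ l' ∈ normalCone K z, ‖l - l'‖ ≤ C * (‖l‖ * ‖w - z‖)

/-- The normal cone mapping of `K` is, to first order, `μ`-strongly monotone between `z` and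
`z + t • H` for `t ↓ 0`, `H` near `D` and normals near `lbar`. For a polyhedral cone one can take
`μ = 0`; curvature of `K` shows up as a larger `μ`. -/
def NormalConeMonotoneAt (K : Set Z) (z lbar D : Z) (μ : ℝ) : Prop :=
  ∀ c < μ, ∀ᶠ p : ℝ × Z × Z × Z in 𝓝[>] 0 ×ˢ 𝓝 lbar ×ˢ 𝓝 lbar ×ˢ 𝓝 D,
    p.2.1 ∈ normalCone K (z + p.1 • p.2.2.2) → p.2.2.1 ∈ normalCone K z →
      c * p.1 ≤ inner ℝ (p.2.1 - p.2.2.1) p.2.2.2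

theorem convex_normalCone (K : Set Z) (z : Z) : Convex ℝ (normalCone K z) := by
  rintro u ⟨hz, hu⟩ v ⟨-, hv⟩ a b ha hb -
  refine ⟨hz, fun w hw => ?_⟩
  rw [inner_add_left, real_inner_smul_left, real_inner_smul_left]
  exact add_nonpos (mul_nonpos_of_nonneg_of_nonpos ha (hu w hw))
    (mul_nonpos_of_nonneg_of_nonpos hb (hv w hw))

theorem exists_normalCone_sub_isBigO {ι : Type*} {𝓕 : Filter ι} {l w : ι → Z} {z : Z}
    (hK : IsNormalConeCalm K z)
    (hl : l =O[𝓕] fun _ => (1 : ℝ)) (hlw : ∀ᶠ i in 𝓕, l i ∈ normalCone K (w i)) :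
    ∃ l' : ι → Z, (∀ᶠ i in 𝓕, l' i ∈ normalCone K z) ∧
      (fun i => l i - l' i) =O[𝓕] fun i => w i - z := by
  obtain ⟨C, hC⟩ := hK
  obtain ⟨l', hl'⟩ := skolem.1 (hlw.mono fun i => hC (w i) (l i))
  have hprod : (fun i => ‖l i‖ * ‖w i - z‖) =O[𝓕] fun i => w i - z := by
    simpa only [one_mul, isBigO_norm_right] using
      hl.norm_left.mul (isBigO_refl (fun i => ‖w i - z‖) 𝓕)
  refine ⟨l', hl'.mono fun i hi => hi.1, (IsBigO.of_bound C ?_).trans hprod⟩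
  filter_upwards [hl'] with i hi
  rw [Real.norm_of_nonneg (by positivity)]
  exact hi.2

end NormalCone

section AbstractProblem

variable {X Z : Type*} [NormedAddCommGroup X] [InnerProductSpace ℝ X] [CompleteSpace X]
  [NormedAddCommGroup Z] [InnerProductSpace ℝ Z] [CompleteSpace Z]

/-- The gradient in `x` of the Lagrangian `f x + ⟪l, g x⟫` of the problem of minimizing `f`
subject to `g x ∈ K`. -/
noncomputable def lagrangeGrad (f : X → ℝ) (g : X → Z) (x : X) (l : Z) : X :=
  gradient f x + adjoint (fderiv ℝ g x) l

/-- The KKT conditions, at the point `x` with multiplier `l`, for the problem of minimizing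
`f x - ⟪a, x⟫` subject to `g x - q ∈ K`. -/
structure IsKKT (f : X → ℝ) (g : X → Z) (K : Set Z) (a : X) (q : Z) (x : X) (l : Z) : Prop where
  lagrangeGrad_eq : lagrangeGrad f g x l = a
  mem_normalCone : l ∈ normalCone K (g x - q)

variable {f : X → ℝ} {g : X → Z} {K : Set Z} {xbar : X} {lbar : Z}

theorem lagrangeGrad_sub_lagrangeGrad (x : X) (l m : Z) :
    lagrangeGrad f g x l - lagrangeGrad f g x m = adjoint (fderiv ℝ g x) (l - m) := by
  rw [lagrangeGrad, lagrangeGrad, add_sub_add_left_eq_sub, map_sub]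

theorem hasFDerivAt_lagrangeGrad (hf : DifferentiableAt ℝ (gradient f) xbar)
    (hg' : DifferentiableAt ℝ (fderiv ℝ g) xbar) (l : Z) :
    HasFDerivAt (fun x => lagrangeGrad f g x l) (fderiv ℝ (gradient f) xbar +
      (fderiv ℝ (fun x => adjoint (fderiv ℝ g x)) xbar).flip l) xbar := by
  refine hf.hasFDerivAt.add ?_
  simpa using (differentiableAt_adjoint_comp hg').hasFDerivAt.clm_apply (hasFDerivAt_const l xbar)

section Family

variable {ι : Type*} {𝓕 : Filter ι} {x a : ι → X} {l q : ι → Z}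

theorem lagrangeGrad_sub_isBigO (hf : DifferentiableAt ℝ (gradient f) xbar)
    (hg' : DifferentiableAt ℝ (fderiv ℝ g) xbar) (hx : Tendsto x 𝓕 (𝓝 xbar))
    (hl : l =O[𝓕] fun _ => (1 : ℝ)) :
    (fun i => lagrangeGrad f g (x i) (l i) - lagrangeGrad f g xbar (l i)) =O[𝓕]
      fun i => x i - xbar := by
  have hgrad := hf.hasFDerivAt.isBigO_sub.comp_tendsto hx
  have hadj := (differentiableAt_adjoint_comp hg').hasFDerivAt.isBigO_sub.comp_tendsto hx
  have hadj_apply := isBoundedBilinearMap_apply.isBigO_comp.trans (hadj.norm_norm.mul hl.norm_left)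
  simp only [mul_one, isBigO_norm_right] at hadj_apply
  refine (hgrad.add hadj_apply).congr_left fun i => ?_
  simp only [lagrangeGrad, Function.comp_apply, _root_.sub_apply]
  abel

theorem lagrangeGrad_isBigO_of_sub_isBigO {l' : ι → Z} {r : ι → ℝ}
    (hf : DifferentiableAt ℝ (gradient f) xbar) (hg' : DifferentiableAt ℝ (fderiv ℝ g) xbar)
    (hx : Tendsto x 𝓕 (𝓝 xbar)) (hl : l =O[𝓕] fun _ => (1 : ℝ))
    (ha : ∀ᶠ i in 𝓕, lagrangeGrad f g (x i) (l i) = a i)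
    (hxr : (fun i => x i - xbar) =O[𝓕] r) (har : a =O[𝓕] r)
    (hlr : (fun i => l i - l' i) =O[𝓕] r) :
    (fun i => lagrangeGrad f g xbar (l' i)) =O[𝓕] r := by
  have hadj := (adjoint (fderiv ℝ g xbar)).isBigO_comp (fun i => l i - l' i) 𝓕
  refine ((har.sub ((lagrangeGrad_sub_isBigO hf hg' hx hl).trans hxr)).sub
    (hadj.trans hlr)).congr' (ha.mono fun i hi => ?_) .rfl
  simp only [← lagrangeGrad_sub_lagrangeGrad (f := f), hi]
  abel

theorem exists_isKKT_sub_isBigO [FiniteDimensional ℝ X]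
    (hf : DifferentiableAt ℝ (gradient f) xbar) (hg : DifferentiableAt ℝ g xbar)
    (hg' : DifferentiableAt ℝ (fderiv ℝ g) xbar) (hK : IsNormalConeCalm K (g xbar)) {v : Z}
    (hv : v ∈ intrinsicInterior ℝ (normalCone K (g xbar))) (hv0 : lagrangeGrad f g xbar v = 0)
    (hx : Tendsto x 𝓕 (𝓝 xbar)) (hl : l =O[𝓕] fun _ => (1 : ℝ)) (hq : Tendsto q 𝓕 (𝓝 0))
    (hkkt : ∀ᶠ i in 𝓕, IsKKT f g K (a i) (q i) (x i) (l i)) :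
    ∃ m : ι → Z, (∀ᶠ i in 𝓕, IsKKT f g K 0 0 xbar (m i)) ∧
      (fun i => l i - m i) =O[𝓕] fun i => ‖x i - xbar‖ + (‖a i‖ + ‖q i‖) := by
  set r : ι → ℝ := fun i => ‖x i - xbar‖ + (‖a i‖ + ‖q i‖)
  have hxr : (fun i => x i - xbar) =O[𝓕] r := .of_norm_le fun i => by
    simp only [r]; linarith [norm_nonneg (a i), norm_nonneg (q i)]
  have har : a =O[𝓕] r := .of_norm_le fun i => by
    simp only [r]; linarith [norm_nonneg (x i - xbar), norm_nonneg (q i)]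
  have hqr : q =O[𝓕] r := .of_norm_le fun i => by
    simp only [r]; linarith [norm_nonneg (x i - xbar), norm_nonneg (a i)]
  have hgr : (fun i => g (x i) - q i - g xbar) =O[𝓕] r :=
    (((hg.hasFDerivAt.isBigO_sub.comp_tendsto hx).trans hxr).sub hqr).congr_left
      fun i => sub_right_comm _ _ _
  obtain ⟨l', hl', hll'⟩ :=
    exists_normalCone_sub_isBigO hK hl (hkkt.mono fun i hi => hi.mem_normalCone)
  have hl'_bounded : l' =O[𝓕] fun _ => (1 : ℝ) := by
    have hg_lim : Tendsto (fun i => g (x i) - q i - g xbar) 𝓕 (𝓝 0) := by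
      simpa using ((hg.continuousAt.tendsto.comp hx).sub hq).sub_const (g xbar)
    exact (hl.sub (hll'.trans (hg_lim.isBigO_one ℝ))).congr_left fun i => sub_sub_cancel _ _
  have hresidual := lagrangeGrad_isBigO_of_sub_isBigO hf hg' hx hl
    (hkkt.mono fun i hi => hi.lagrangeGrad_eq) hxr har (hll'.trans hgr)
  have hadj_sub (l : Z) : adjoint (fderiv ℝ g xbar) l - adjoint (fderiv ℝ g xbar) v =
      lagrangeGrad f g xbar l := by
    rw [← map_sub, ← lagrangeGrad_sub_lagrangeGrad (f := f), hv0, sub_zero]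
  obtain ⟨m, hm, hl'm⟩ := exists_mem_eq_sub_isBigO (adjoint (fderiv ℝ g xbar)).toLinearMap
    (convex_normalCone K (g xbar)) hv hl'_bounded hl'
  refine ⟨m, hm.mono fun i hi => ⟨?_, by rw [sub_zero]; exact hi.1⟩, ?_⟩
  · rw [← hadj_sub]
    exact sub_eq_zero.2 hi.2
  · exact ((hll'.trans hgr).add ((hl'm.congr_right fun i => hadj_sub (l' i)).trans
      hresidual)).congr_left fun i => sub_add_sub_cancel _ _ _

end Family

section CriticalSequence

variable {d : X} {t : ℕ → ℝ} {x a : ℕ → X} {l q : ℕ → Z}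

/-- Solutions `(x k, l k)` of KKT systems perturbed by `(a k, q k)` for which `x k` tends to
`xbar` from the direction `d` at rate `t k`, `l k` tends to `lbar`, and the perturbations are
`o(t k)`. -/
structure IsCriticalSequence (f : X → ℝ) (g : X → Z) (K : Set Z) (xbar : X) (lbar : Z) (d : X)
    (t : ℕ → ℝ) (x : ℕ → X) (l : ℕ → Z) (a : ℕ → X) (q : ℕ → Z) : Prop where
  pos : ∀ k, 0 < t k
  tendsto_rate : Tendsto t atTop (𝓝 0)
  tendsto_direction : Tendsto (fun k => (t k)⁻¹ • (x k - xbar)) atTop (𝓝 d)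
  tendsto_multiplier : Tendsto l atTop (𝓝 lbar)
  tendsto_inv_smul_left : Tendsto (fun k => (t k)⁻¹ • a k) atTop (𝓝 0)
  tendsto_inv_smul_right : Tendsto (fun k => (t k)⁻¹ • q k) atTop (𝓝 0)
  isKKT : ∀ k, IsKKT f g K (a k) (q k) (x k) (l k)

namespace IsCriticalSequence

theorem isBigO_rate {E : Type*} [NormedAddCommGroup E] [NormedSpace ℝ E] {u : ℕ → E} {u₀ : E}
    (hs : IsCriticalSequence f g K xbar lbar d t x l a q)
    (hu : Tendsto (fun k => (t k)⁻¹ • u k) atTop (𝓝 u₀)) : u =O[atTop] t := by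
  refine ((isBigO_refl t atTop).smul (hu.isBigO_one ℝ)).congr (fun k => ?_) fun k => mul_one _
  exact smul_inv_smul₀ (hs.pos k).ne' _

theorem tendsto_of_sub_isBigO {E : Type*} [NormedAddCommGroup E] {u v : ℕ → E} {u₀ : E}
    (hs : IsCriticalSequence f g K xbar lbar d t x l a q)
    (hu : Tendsto u atTop (𝓝 u₀)) (huv : (fun k => u k - v k) =O[atTop] t) :
    Tendsto v atTop (𝓝 u₀) := by
  simpa using hu.sub (huv.trans_tendsto hs.tendsto_rate)

theorem tendsto_point (hs : IsCriticalSequence f g K xbar lbar d t x l a q) :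
    Tendsto x atTop (𝓝 xbar) :=
  tendsto_sub_nhds_zero_iff.1 ((hs.isBigO_rate hs.tendsto_direction).trans_tendsto hs.tendsto_rate)

theorem tendsto_constraint_direction (hs : IsCriticalSequence f g K xbar lbar d t x l a q)
    (hg : DifferentiableAt ℝ g xbar) :
    Tendsto (fun k => (t k)⁻¹ • (g (x k) - q k - g xbar)) atTop (𝓝 (fderiv ℝ g xbar d)) := by
  have hlim := (tendsto_inv_smul_sub_of_hasFDerivAt hg.hasFDerivAt hs.tendsto_point
    hs.tendsto_direction).sub hs.tendsto_inv_smul_right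
  rw [sub_zero] at hlim
  refine hlim.congr fun k => ?_
  rw [← smul_sub, sub_right_comm]

theorem add_smul_constraint_direction (hs : IsCriticalSequence f g K xbar lbar d t x l a q)
    (k : ℕ) : g xbar + t k • (t k)⁻¹ • (g (x k) - q k - g xbar) = g (x k) - q k := by
  rw [smul_inv_smul₀ (hs.pos k).ne', add_sub_cancel]

theorem fderiv_mem_criticalCone (hs : IsCriticalSequence f g K xbar lbar d t x l a q)
    (hg : DifferentiableAt ℝ g xbar) (hlbar : lbar ∈ normalCone K (g xbar)) :
    fderiv ℝ g xbar d ∈ criticalCone K (g xbar) lbar := by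
  have hH := hs.tendsto_constraint_direction hg
  refine ⟨⟨t, _, hs.pos, hs.tendsto_rate, hH, fun k => ?_⟩, le_antisymm ?_ ?_⟩
  · rw [hs.add_smul_constraint_direction]
    exact (hs.isKKT k).mem_normalCone.1
  · refine le_of_tendsto ((tendsto_const_nhds (x := lbar)).inner hH) (.of_forall fun k => ?_)
    rw [real_inner_smul_right]
    exact mul_nonpos_of_nonneg_of_nonpos (inv_nonneg.2 (hs.pos k).le)
      (hlbar.2 _ (hs.isKKT k).mem_normalCone.1)
  · refine ge_of_tendsto (hs.tendsto_multiplier.inner hH) (.of_forall fun k => ?_)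
    have hnormal := (hs.isKKT k).mem_normalCone.2 _ hlbar.1
    rw [← neg_sub, inner_neg_right, neg_nonpos] at hnormal
    rw [real_inner_smul_right]
    exact mul_nonneg (inv_nonneg.2 (hs.pos k).le) hnormal

theorem tendsto_inv_smul_lagrangeGrad_sub (hs : IsCriticalSequence f g K xbar lbar d t x l a q)
    (hf : DifferentiableAt ℝ (gradient f) xbar) (hg' : DifferentiableAt ℝ (fderiv ℝ g) xbar) :
    Tendsto (fun k => (t k)⁻¹ • (lagrangeGrad f g (x k) (l k) - lagrangeGrad f g xbar (l k))) atTop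
      (𝓝 (fderiv ℝ (fun x => lagrangeGrad f g x lbar) xbar d)) := by
  have hgrad := tendsto_inv_smul_sub_of_hasFDerivAt hf.hasFDerivAt hs.tendsto_point
    hs.tendsto_direction
  have hadj := tendsto_inv_smul_sub_of_hasFDerivAt (differentiableAt_adjoint_comp hg').hasFDerivAt
    hs.tendsto_point hs.tendsto_direction
  rw [(hasFDerivAt_lagrangeGrad hf hg' lbar).fderiv]
  refine (hgrad.add (isBoundedBilinearMap_apply.continuous.tendsto _ |>.comp
    (hadj.prodMk_nhds hs.tendsto_multiplier))).congr fun k => ?_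
  simp only [Function.comp_apply, lagrangeGrad, _root_.smul_apply, _root_.sub_apply, ← smul_add]
  congr 1
  abel

-- Pairing the difference of the KKT systems at `(x k, l k)` and `(xbar, m k)` with `x k - xbar`
-- turns the multiplier term into `⟪l k - m k, g (x k) - q k - g xbar⟫` up to `o(t k ^ 2)`.
theorem tendsto_inner_multiplier_sub (hs : IsCriticalSequence f g K xbar lbar d t x l a q)
    (hf : DifferentiableAt ℝ (gradient f) xbar) (hg : DifferentiableAt ℝ g xbar)
    (hg' : DifferentiableAt ℝ (fderiv ℝ g) xbar) {m : ℕ → Z}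
    (hm : ∀ᶠ k in atTop, lagrangeGrad f g xbar (m k) = 0)
    (hlm : (fun k => l k - m k) =O[atTop] t) :
    Tendsto (fun k => inner ℝ ((t k)⁻¹ • (l k - m k)) ((t k)⁻¹ • (g (x k) - q k - g xbar))) atTop
      (𝓝 (-inner ℝ (fderiv ℝ (fun x => lagrangeGrad f g x lbar) xbar d) d)) := by
  set ζ : ℕ → Z := fun k => (t k)⁻¹ • (l k - m k)
  set e : ℕ → X := fun k => (t k)⁻¹ • (x k - xbar)
  set H : ℕ → Z := fun k => (t k)⁻¹ • (g (x k) - q k - g xbar)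
  set Q : ℕ → X := fun k =>
    (t k)⁻¹ • (lagrangeGrad f g (x k) (l k) - lagrangeGrad f g xbar (l k))
  have hζ_bounded : ζ =O[atTop] fun _ => (1 : ℝ) := by
    refine ((isBigO_refl (fun k => (t k)⁻¹) atTop).smul hlm).congr_right fun k => ?_
    exact inv_mul_cancel₀ (hs.pos k).ne'
  have hremainder : Tendsto (fun k => inner ℝ (ζ k) (fderiv ℝ g xbar (e k) - H k)) atTop (𝓝 0) := by
    refine tendsto_inner_zero_of_isBigO_one hζ_bounded ?_
    rw [← sub_self (fderiv ℝ g xbar d)]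
    exact (((fderiv ℝ g xbar).continuous.tendsto d).comp hs.tendsto_direction).sub
      (hs.tendsto_constraint_direction hg)
  have hmain : Tendsto (fun k => inner ℝ ((t k)⁻¹ • a k - Q k) (e k)) atTop
      (𝓝 (-inner ℝ (fderiv ℝ (fun x => lagrangeGrad f g x lbar) xbar d) d)) := by
    simpa using (hs.tendsto_inv_smul_left.sub
      (hs.tendsto_inv_smul_lagrangeGrad_sub hf hg')).inner hs.tendsto_direction
  rw [← sub_zero (-inner ℝ _ _)]
  refine (hmain.sub hremainder).congr' (hm.mono fun k hmk => ?_)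
  have hadj : adjoint (fderiv ℝ g xbar) (ζ k) = (t k)⁻¹ • a k - Q k := by
    simp only [ζ, Q, map_smul, ← lagrangeGrad_sub_lagrangeGrad (f := f), hmk,
      (hs.isKKT k).lagrangeGrad_eq, ← smul_sub]
    congr 1
    abel
  rw [← hadj, adjoint_inner_left, ← inner_sub_right, sub_sub_cancel]

theorem inner_hess_add_nonpos (hs : IsCriticalSequence f g K xbar lbar d t x l a q)
    (hf : DifferentiableAt ℝ (gradient f) xbar) (hg : DifferentiableAt ℝ g xbar)
    (hg' : DifferentiableAt ℝ (fderiv ℝ g) xbar) {m : ℕ → Z}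
    (hm : ∀ᶠ k in atTop, IsKKT f g K 0 0 xbar (m k))
    (hlm : (fun k => l k - m k) =O[atTop] t) {μ : ℝ}
    (hμ : NormalConeMonotoneAt K (g xbar) lbar (fderiv ℝ g xbar d) μ) :
    inner ℝ (fderiv ℝ (fun x => lagrangeGrad f g x lbar) xbar d) d + μ ≤ 0 := by
  have hH := hs.tendsto_constraint_direction hg
  have hrate : Tendsto t atTop (𝓝[>] 0) :=
    tendsto_nhdsWithin_iff.2 ⟨hs.tendsto_rate, .of_forall hs.pos⟩
  rw [← le_neg_iff_add_nonpos_left]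
  refine le_of_forall_lt_imp_le_of_dense fun c hc => ge_of_tendsto
    (hs.tendsto_inner_multiplier_sub hf hg hg' (hm.mono fun k hk => hk.lagrangeGrad_eq) hlm) ?_
  filter_upwards [hm, (hrate.prodMk (hs.tendsto_multiplier.prodMk
    ((hs.tendsto_of_sub_isBigO hs.tendsto_multiplier hlm).prodMk hH))).eventually (hμ c hc)]
    with k hmk hmono
  simp only [hs.add_smul_constraint_direction] at hmono
  rw [real_inner_smul_left, ← div_eq_inv_mul, le_div_iff₀ (hs.pos k)]
  exact hmono (hs.isKKT k).mem_normalCone (by simpa only [sub_zero] using hmk.mem_normalCone)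

end IsCriticalSequence

end CriticalSequence

section SemiIsolatedCalmness

/-- The second-order sufficient condition at `xbar` with multiplier `lbar`, the contribution of
the curvature of `K` along `D` being any admissible `μ` in `NormalConeMonotoneAt`. -/
def SecondOrderSufficient (f : X → ℝ) (g : X → Z) (K : Set Z) (xbar : X) (lbar : Z) : Prop :=
  ∀ d ≠ 0, fderiv ℝ g xbar d ∈ criticalCone K (g xbar) lbar →
    ∃ μ : ℝ, NormalConeMonotoneAt K (g xbar) lbar (fderiv ℝ g xbar d) μ ∧
      0 < inner ℝ (fderiv ℝ (fun x => lagrangeGrad f g x lbar) xbar d) d + μ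

variable {ι : Type*} {𝓕 : Filter ι} {x a : ι → X} {l q : ι → Z} {v : Z}

theorem exists_isCriticalSequence_of_not_isBigO [FiniteDimensional ℝ X] [𝓕.IsCountablyGenerated]
    (hx : Tendsto x 𝓕 (𝓝 xbar)) (hl : Tendsto l 𝓕 (𝓝 lbar))
    (hkkt : ∀ᶠ i in 𝓕, IsKKT f g K (a i) (q i) (x i) (l i))
    (h : ¬ (fun i => x i - xbar) =O[𝓕] fun i => ‖a i‖ + ‖q i‖) :
    ∃ (s : ℕ → ι) (t : ℕ → ℝ) (d : X), d ≠ 0 ∧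
      IsCriticalSequence f g K xbar lbar d t (x ∘ s) (l ∘ s) (a ∘ s) (q ∘ s) := by
  obtain ⟨s, hs, hne, hlittle⟩ := exists_seq_isLittleO_of_not_isBigO h
  let t : ℕ → ℝ := fun k => ‖x (s k) - xbar‖
  have ht_pos (k : ℕ) : 0 < t k := norm_pos_iff.2 (hne k)
  have ht : Tendsto t atTop (𝓝 0) := by
    simpa using ((hx.comp hs).sub_const xbar).norm
  have hsphere (k : ℕ) : (t k)⁻¹ • (x (s k) - xbar) ∈ Metric.sphere (0 : X) 1 := by
    rw [mem_sphere_zero_iff_norm, norm_smul, norm_inv, norm_norm, inv_mul_cancel₀ (ht_pos k).ne']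
  obtain ⟨d, hd, φ, hφ, hφd⟩ := (isCompact_sphere (0 : X) 1).tendsto_subseq hsphere
  obtain ⟨N, hN⟩ := eventually_atTop.1 (hs.eventually hkkt)
  have ha : (a ∘ s) =o[atTop] t := IsBigO.trans_isLittleO
    (.of_norm_le fun k => le_add_of_nonneg_right (norm_nonneg (q (s k)))) hlittle.norm_right
  have hq : (q ∘ s) =o[atTop] t := IsBigO.trans_isLittleO
    (.of_norm_le fun k => le_add_of_nonneg_left (norm_nonneg (a (s k)))) hlittle.norm_right
  have hψ : Tendsto (fun k => φ (k + N)) atTop atTop :=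
    hφ.tendsto_atTop.comp (tendsto_add_atTop_nat N)
  exact ⟨fun k => s (φ (k + N)), fun k => t (φ (k + N)), d, ne_zero_of_mem_unit_sphere ⟨d, hd⟩,
    { pos := fun k => ht_pos _
      tendsto_rate := ht.comp hψ
      tendsto_direction := hφd.comp (tendsto_add_atTop_nat N)
      tendsto_multiplier := (hl.comp hs).comp hψ
      tendsto_inv_smul_left := ha.tendsto_inv_smul_nhds_zero.comp hψ
      tendsto_inv_smul_right := hq.tendsto_inv_smul_nhds_zero.comp hψ
      isKKT := fun k => hN _ (le_trans (by lia) hφ.le_apply) }⟩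

theorem sub_isBigO_of_secondOrderSufficient [FiniteDimensional ℝ X] [𝓕.IsCountablyGenerated]
    (hf : DifferentiableAt ℝ (gradient f) xbar) (hg : DifferentiableAt ℝ g xbar)
    (hg' : DifferentiableAt ℝ (fderiv ℝ g) xbar) (hK : IsNormalConeCalm K (g xbar))
    (hlbar : lbar ∈ normalCone K (g xbar)) (hsoc : SecondOrderSufficient f g K xbar lbar)
    (hv : v ∈ intrinsicInterior ℝ (normalCone K (g xbar))) (hv0 : lagrangeGrad f g xbar v = 0)
    (hx : Tendsto x 𝓕 (𝓝 xbar)) (hl : Tendsto l 𝓕 (𝓝 lbar))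
    (hkkt : ∀ᶠ i in 𝓕, IsKKT f g K (a i) (q i) (x i) (l i)) :
    (fun i => x i - xbar) =O[𝓕] fun i => ‖a i‖ + ‖q i‖ := by
  by_contra h
  obtain ⟨s, t, d, hd, hs⟩ := exists_isCriticalSequence_of_not_isBigO hx hl hkkt h
  obtain ⟨μ, hμ, hpos⟩ := hsoc d hd (hs.fderiv_mem_criticalCone hg hlbar)
  have hx_rate := hs.isBigO_rate hs.tendsto_direction
  have ha_rate := hs.isBigO_rate hs.tendsto_inv_smul_left
  have hq_rate := hs.isBigO_rate hs.tendsto_inv_smul_right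
  obtain ⟨m, hm, hlm⟩ := exists_isKKT_sub_isBigO hf hg hg' hK hv hv0 hs.tendsto_point
    (hs.tendsto_multiplier.isBigO_one ℝ) (hq_rate.trans_tendsto hs.tendsto_rate)
    (.of_forall hs.isKKT)
  have hlm_rate := hlm.trans (hx_rate.norm_left.add (ha_rate.norm_left.add hq_rate.norm_left))
  exact hpos.not_ge (hs.inner_hess_add_nonpos hf hg hg' hm hlm_rate hμ)

theorem norm_sub_add_infDist_isBigO [FiniteDimensional ℝ X] [𝓕.IsCountablyGenerated]
    (hf : DifferentiableAt ℝ (gradient f) xbar) (hg : DifferentiableAt ℝ g xbar)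
    (hg' : DifferentiableAt ℝ (fderiv ℝ g) xbar) (hK : IsNormalConeCalm K (g xbar))
    (hlbar : lbar ∈ normalCone K (g xbar)) (hsoc : SecondOrderSufficient f g K xbar lbar)
    (hv : v ∈ intrinsicInterior ℝ (normalCone K (g xbar))) (hv0 : lagrangeGrad f g xbar v = 0)
    (hx : Tendsto x 𝓕 (𝓝 xbar)) (hl : Tendsto l 𝓕 (𝓝 lbar)) (hq : Tendsto q 𝓕 (𝓝 0))
    (hkkt : ∀ᶠ i in 𝓕, IsKKT f g K (a i) (q i) (x i) (l i)) :
    (fun i => ‖x i - xbar‖ + Metric.infDist (l i) {m | IsKKT f g K 0 0 xbar m}) =O[𝓕]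
      fun i => ‖a i‖ + ‖q i‖ := by
  have hxO := sub_isBigO_of_secondOrderSufficient hf hg hg' hK hlbar hsoc hv hv0 hx hl hkkt
  obtain ⟨m, hm, hlm⟩ :=
    exists_isKKT_sub_isBigO hf hg hg' hK hv hv0 hx (hl.isBigO_one ℝ) hq hkkt
  have hdist : (fun i => Metric.infDist (l i) {m | IsKKT f g K 0 0 xbar m}) =O[𝓕]
      fun i => l i - m i := by
    refine .of_bound' (hm.mono fun i hi => ?_)
    rw [Real.norm_of_nonneg Metric.infDist_nonneg, ← dist_eq_norm]
    exact Metric.infDist_le_dist_of_mem hi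
  exact hxO.norm_left.add (hdist.trans (hlm.trans (hxO.norm_left.add (isBigO_refl _ _))))

end SemiIsolatedCalmness

end AbstractProblem

section PosSemidef

open scoped Matrix ComplexOrder

variable {m 𝕜 : Type*} [Fintype m] [RCLike 𝕜] {M N : Matrix m m 𝕜}

open scoped MatrixOrder Matrix.Norms.L2Operator in
theorem exists_eq_conjTranspose_mul_self_of_posSemidef (hM : M.PosSemidef) :
    ∃ B : Matrix m m 𝕜, M = Bᴴ * B := by
  classical
  exact CStarAlgebra.nonneg_iff_eq_star_mul_self.mp hM.nonneg

theorem trace_mul_nonneg_of_posSemidef (hM : M.PosSemidef) (hN : N.PosSemidef) :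
    0 ≤ (M * N).trace := by
  obtain ⟨C, rfl⟩ := exists_eq_conjTranspose_mul_self_of_posSemidef hN
  rw [← Matrix.mul_assoc, Matrix.trace_mul_comm, ← Matrix.mul_assoc]
  exact (hM.mul_mul_conjTranspose_same C).trace_nonneg

theorem mul_eq_zero_of_posSemidef_of_trace_mul_eq_zero (hM : M.PosSemidef) (hN : N.PosSemidef)
    (h : (M * N).trace = 0) : M * N = 0 := by
  obtain ⟨B, rfl⟩ := exists_eq_conjTranspose_mul_self_of_posSemidef hM
  obtain ⟨C, rfl⟩ := exists_eq_conjTranspose_mul_self_of_posSemidef hN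
  have hgram : ((B * Cᴴ)ᴴ * (B * Cᴴ)).trace = 0 := by
    rw [← h, Matrix.trace_mul_comm (Bᴴ * B), Matrix.conjTranspose_mul,
      Matrix.conjTranspose_conjTranspose, Matrix.trace_mul_comm, Matrix.mul_assoc,
      Matrix.trace_mul_comm]
    simp only [Matrix.mul_assoc]
  rw [Matrix.mul_assoc, ← Matrix.mul_assoc B,
    Matrix.trace_conjTranspose_mul_self_eq_zero_iff.1 hgram, Matrix.zero_mul, Matrix.mul_zero]

end PosSemidef

namespace SymMat

open scoped Matrix

variable {n : ℕ}

theorem mat_sub (A B : SymMat n) : (A - B).mat = A.mat - B.mat := rfl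

theorem mat_neg (A : SymMat n) : (-A).mat = -A.mat := rfl

theorem mat_smul (c : ℝ) (A : SymMat n) : (c • A).mat = c • A.mat := rfl

theorem mat_transpose (A : SymMat n) : A.matᵀ = A.mat := A.isHermitian

theorem mat_mul_mat_comm_eq_zero {A B : SymMat n} (h : A.mat * B.mat = 0) :
    B.mat * A.mat = 0 := by
  rw [← A.mat_transpose, ← B.mat_transpose, ← Matrix.transpose_mul, h, Matrix.transpose_zero]

theorem continuous_mat : Continuous (SymMat.mat : SymMat n → Matrix (Fin n) (Fin n) ℝ) :=
  continuous_matrix fun i j => (PiLp.continuous_apply 2 _ (i, j)).comp continuous_subtype_val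

open scoped Matrix.Norms.Frobenius in
theorem norm_mat (A : SymMat n) : ‖A.mat‖ = ‖A‖ := by
  rw [Matrix.frobenius_norm_def, Submodule.coe_norm, EuclideanSpace.norm_eq,
    Fintype.sum_prod_type, Real.sqrt_eq_rpow]
  simp [SymMat.mat]

theorem pinv_transpose (A : SymMat n) : A.pinvᵀ = A.pinv := by
  have hpinv : A.pinv.IsHermitian :=
    Matrix.isHermitian_mul_mul_conjTranspose _ (Matrix.isHermitian_diagonal _)
  rwa [Matrix.IsHermitian, Matrix.conjTranspose_eq_transpose_of_trivial] at hpinv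

theorem mat_mul_pinv_comm (A : SymMat n) : A.mat * A.pinv = A.pinv * A.mat := by
  obtain ⟨-, -, hsymm, -⟩ := A.penrose
  rw [← hsymm, Matrix.transpose_mul, A.pinv_transpose, A.mat_transpose]

theorem mul_mat_mul_transpose_isSymm (P : Matrix (Fin n) (Fin n) ℝ) (A : SymMat n) :
    (P * A.mat * Pᵀ).IsSymm :=
  Matrix.isHermitian_mul_mul_conjTranspose P A.isHermitian

end SymMat

section PsdCone

open scoped Matrix

variable {n : ℕ} {A B Γ : SymMat n}

theorem inner_nonpos_of_mem_nsdCone (hΓ : Γ ∈ nsdCone n) (hA : A ∈ psdCone n) :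
    inner ℝ Γ A ≤ 0 := by
  have htrace := trace_mul_nonneg_of_posSemidef hΓ hA
  rwa [← SymMat.inner_eq_trace, inner_neg_left, neg_nonneg] at htrace

theorem mem_nsdCone_of_forall_psdCone_inner_nonpos (h : ∀ A ∈ psdCone n, inner ℝ Γ A ≤ 0) :
    Γ ∈ nsdCone n := by
  refine Matrix.PosSemidef.of_dotProduct_mulVec_nonneg (SymMat.isHermitian _) fun v => ?_
  have hpsd : (Matrix.vecMulVec v v).PosSemidef := by
    simpa using Matrix.posSemidef_vecMulVec_self_star v
  have hsymm : (Matrix.vecMulVec v v).IsSymm := Matrix.transpose_vecMulVec v v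
  have hrank_one := h (SymMat.ofMat _ hsymm) hpsd
  rw [SymMat.inner_eq_trace, SymMat.mat_ofMat, Matrix.mul_vecMulVec, Matrix.trace_vecMulVec,
    dotProduct_comm] at hrank_one
  rw [SymMat.mat_neg, Matrix.neg_mulVec, dotProduct_neg, neg_nonneg]
  simpa using hrank_one

theorem mem_normalCone_psdCone :
    Γ ∈ normalCone (psdCone n) A ↔ A ∈ psdCone n ∧ Γ ∈ nsdCone n ∧ inner ℝ Γ A = 0 := by
  constructor
  · rintro ⟨hA, hnormal⟩
    have hzero : 0 ≤ inner ℝ Γ A := by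
      simpa using hnormal 0 (Matrix.PosSemidef.zero : (0 : Matrix (Fin n) (Fin n) ℝ).PosSemidef)
    have hadd (B : SymMat n) (hB : B ∈ psdCone n) : inner ℝ Γ B ≤ 0 := by
      simpa using hnormal (A + B) (Matrix.PosSemidef.add hA hB)
    exact ⟨hA, mem_nsdCone_of_forall_psdCone_inner_nonpos hadd, le_antisymm (hadd A hA) hzero⟩
  · rintro ⟨hA, hΓ, horth⟩
    refine ⟨hA, fun B hB => ?_⟩
    rw [inner_sub_right, horth, sub_zero]
    exact inner_nonpos_of_mem_nsdCone hΓ hB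

theorem mat_mul_eq_zero_of_mem_normalCone (hΓ : Γ ∈ normalCone (psdCone n) A) :
    Γ.mat * A.mat = 0 := by
  obtain ⟨hA, hneg, horth⟩ := mem_normalCone_psdCone.1 hΓ
  have hmul := mul_eq_zero_of_posSemidef_of_trace_mul_eq_zero hneg hA
    (by rw [← SymMat.inner_eq_trace, inner_neg_left, horth, neg_zero])
  rwa [SymMat.mat_neg, Matrix.neg_mul, neg_eq_zero] at hmul

theorem pinv_mul_mat_mul_mat_sub (hΓ : Γ ∈ normalCone (psdCone n) B) (A : SymMat n) :
    A.pinv * A.mat * Γ.mat = -(A.pinv * (B - A).mat * Γ.mat) := by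
  rw [SymMat.mat_sub, Matrix.mul_sub, Matrix.sub_mul, Matrix.mul_assoc _ B.mat,
    SymMat.mat_mul_mat_comm_eq_zero (mat_mul_eq_zero_of_mem_normalCone hΓ), Matrix.mul_zero,
    zero_sub, neg_neg]

open scoped Matrix.Norms.Frobenius in
theorem isNormalConeCalm_psdCone (hA : A ∈ psdCone n) : IsNormalConeCalm (psdCone n) A := by
  obtain ⟨hAJA, -, -, -⟩ := A.penrose
  set J := A.pinv with hJ
  set P : Matrix (Fin n) (Fin n) ℝ := 1 - A.mat * J with hP
  have hPT : Pᵀ = P := by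
    rw [hP, Matrix.transpose_sub, Matrix.transpose_one, Matrix.transpose_mul, A.pinv_transpose,
      A.mat_transpose, A.mat_mul_pinv_comm]
  have hPA : P * A.mat = 0 := by rw [hP, Matrix.sub_mul, hAJA, Matrix.one_mul, sub_self]
  -- The normal at `A` close to `Γ` is the compression of `Γ` to the kernel of `A`.
  refine ⟨(1 + ‖P‖) * ‖J‖, fun B Γ hΓ => ⟨SymMat.ofMat _ (Γ.mul_mat_mul_transpose_isSymm P),
    mem_normalCone_psdCone.2 ⟨hA, ?_, ?_⟩, ?_⟩⟩
  · have hcompression := (mem_normalCone_psdCone.1 hΓ).2.1.mul_mul_conjTranspose_same P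
    rwa [SymMat.mat_neg, Matrix.mul_neg, Matrix.neg_mul] at hcompression
  · rw [SymMat.inner_eq_trace, SymMat.mat_ofMat, hPT, Matrix.mul_assoc, hPA, Matrix.mul_zero,
      Matrix.trace_zero]
  · have hrange : (1 - P) * Γ.mat = -(J * (B - A).mat * Γ.mat) := by
      rw [hP, sub_sub_cancel, A.mat_mul_pinv_comm, pinv_mul_mat_mul_mat_sub hΓ]
    have hrange' : Γ.mat * (1 - P) = -(Γ.mat * (B - A).mat * J) := by
      have htranspose := congrArg Matrix.transpose hrange
      simpa only [Matrix.transpose_mul, Matrix.transpose_sub, Matrix.transpose_neg,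
        Matrix.transpose_one, hPT, hJ, A.pinv_transpose, SymMat.mat_transpose,
        Matrix.mul_assoc] using htranspose
    have hdecomp : Γ.mat - P * Γ.mat * Pᵀ = (1 - P) * Γ.mat + P * (Γ.mat * (1 - P)) := by
      rw [hPT]; noncomm_ring
    rw [← SymMat.norm_mat, SymMat.mat_sub, SymMat.mat_ofMat, hdecomp, hrange, hrange',
      ← SymMat.norm_mat Γ, ← SymMat.norm_mat (B - A)]
    calc ‖-(J * (B - A).mat * Γ.mat) + P * -(Γ.mat * (B - A).mat * J)‖
        ≤ ‖J * (B - A).mat * Γ.mat‖ + ‖P‖ * ‖Γ.mat * (B - A).mat * J‖ := by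
          refine (norm_add_le _ _).trans (add_le_add (norm_neg _).le ?_)
          exact (norm_mul_le _ _).trans_eq (by rw [norm_neg])
      _ ≤ ‖J‖ * ‖(B - A).mat‖ * ‖Γ.mat‖ + ‖P‖ * (‖Γ.mat‖ * ‖(B - A).mat‖ * ‖J‖) := by
          gcongr <;> exact norm_mul₃_le
      _ = (1 + ‖P‖) * ‖J‖ * (‖Γ.mat‖ * ‖(B - A).mat‖) := by ring

/-- The third-order term `⟨Γ, W A† W A† W⟩` in the expansion of the positive semidefinite cone
around `A`, the second-order term being `sigmaTerm`. -/
noncomputable def cubicTerm (A Γ W : SymMat n) : ℝ :=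
  (Γ.mat * (W.mat * A.pinv * W.mat * A.pinv * W.mat)).trace

theorem sigmaTerm_smul (A Γ W : SymMat n) (t : ℝ) :
    sigmaTerm A Γ (t • W) = t ^ 2 * sigmaTerm A Γ W := by
  simp only [sigmaTerm, SymMat.mat_smul, Matrix.smul_mul, Matrix.mul_smul, Matrix.trace_smul,
    smul_eq_mul]
  ring

theorem cubicTerm_smul (A Γ W : SymMat n) (t : ℝ) :
    cubicTerm A Γ (t • W) = t ^ 3 * cubicTerm A Γ W := by
  simp only [cubicTerm, SymMat.mat_smul, Matrix.smul_mul, Matrix.mul_smul, Matrix.trace_smul,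
    smul_eq_mul]
  ring

theorem continuous_sigmaTerm (A : SymMat n) :
    Continuous fun p : SymMat n × SymMat n => sigmaTerm A p.1 p.2 := by
  have hΓ := SymMat.continuous_mat.comp (continuous_fst (X := SymMat n) (Y := SymMat n))
  have hW := SymMat.continuous_mat.comp (continuous_snd (X := SymMat n) (Y := SymMat n))
  exact continuous_const.mul
    (hΓ.matrix_mul ((hW.matrix_mul continuous_const).matrix_mul hW)).matrix_trace

theorem continuous_cubicTerm (A : SymMat n) :
    Continuous fun p : SymMat n × SymMat n => cubicTerm A p.1 p.2 := by
  have hΓ := SymMat.continuous_mat.comp (continuous_fst (X := SymMat n) (Y := SymMat n))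
  have hW := SymMat.continuous_mat.comp (continuous_snd (X := SymMat n) (Y := SymMat n))
  exact (hΓ.matrix_mul ((((hW.matrix_mul continuous_const).matrix_mul hW).matrix_mul
    continuous_const).matrix_mul hW)).matrix_trace

theorem inner_sub_eq_neg_sigmaTerm (A : SymMat n) (hΓ : Γ ∈ normalCone (psdCone n) B) :
    inner ℝ Γ (B - A) = -(sigmaTerm A Γ (B - A) / 2) := by
  obtain ⟨hAJA, -, -, -⟩ := A.penrose
  have hΓB := mat_mul_eq_zero_of_mem_normalCone hΓ
  have hΓA : Γ.mat * A.mat = -(Γ.mat * (B - A).mat) := by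
    rw [SymMat.mat_sub, Matrix.mul_sub, hΓB, zero_sub, neg_neg]
  have hAΓ : A.mat * Γ.mat = -((B - A).mat * Γ.mat) := by
    rw [SymMat.mat_sub, Matrix.sub_mul, SymMat.mat_mul_mat_comm_eq_zero hΓB, zero_sub, neg_neg]
  have hAΓA : A.mat * Γ.mat * A.mat = (B - A).mat * Γ.mat * (B - A).mat := by
    rw [Matrix.mul_assoc, hΓA, Matrix.mul_neg, ← Matrix.mul_assoc, hAΓ, Matrix.neg_mul, neg_neg]
  calc inner ℝ Γ (B - A) = -(Γ.mat * A.mat).trace := by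
        rw [SymMat.inner_eq_trace, hΓA, Matrix.trace_neg, neg_neg]
    _ = -(Γ.mat * A.mat * A.pinv * A.mat).trace := by
        rw [Matrix.mul_assoc, Matrix.mul_assoc, ← Matrix.mul_assoc A.mat, hAJA]
    _ = -(A.mat * Γ.mat * A.mat * A.pinv).trace := by
        rw [Matrix.trace_mul_comm]; simp only [Matrix.mul_assoc]
    _ = -((B - A).mat * (Γ.mat * (B - A).mat * A.pinv)).trace := by
        rw [hAΓA]; simp only [Matrix.mul_assoc]
    _ = -(sigmaTerm A Γ (B - A) / 2) := by
        rw [Matrix.trace_mul_comm, sigmaTerm]; simp only [Matrix.mul_assoc]; ring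

-- With `W = B - A`, this expresses that the congruence `(1 - W A†) B (1 - A† W)` is positive
-- semidefinite; modulo terms annihilated by `Γ` it equals `W - W A† W + W A† W A† W`.
theorem inner_sub_le_sigmaTerm_sub_cubicTerm (hΓ : Γ ∈ normalCone (psdCone n) A)
    (hB : B ∈ psdCone n) :
    inner ℝ Γ (B - A) ≤ sigmaTerm A Γ (B - A) / 2 - cubicTerm A Γ (B - A) := by
  obtain ⟨-, hJAJ, -, -⟩ := A.penrose
  have hΓA := mat_mul_eq_zero_of_mem_normalCone hΓ
  have hAΓ := SymMat.mat_mul_mat_comm_eq_zero hΓA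
  set J := A.pinv
  set W := (B - A).mat
  have hBW : B.mat = A.mat + W := (add_sub_cancel A.mat B.mat).symm
  have hcongr := trace_mul_nonneg_of_posSemidef (mem_normalCone_psdCone.1 hΓ).2.1
    (hB.mul_mul_conjTranspose_same (1 - W * J))
  have hfactor : (1 - W * J)ᴴ = 1 - J * W := by
    rw [Matrix.conjTranspose_eq_transpose_of_trivial, Matrix.transpose_sub, Matrix.transpose_one,
      Matrix.transpose_mul, A.pinv_transpose, SymMat.mat_transpose]
  have hexpand : Γ.mat * ((1 - W * J) * (A.mat + W) * (1 - J * W)) =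
      Γ.mat * W + Γ.mat * A.mat * (1 - J * W) - Γ.mat * W * J * A.mat
        + Γ.mat * W * (J * A.mat * J) * W - (2 : ℝ) • (Γ.mat * (W * J * W))
        + Γ.mat * (W * J * W * J * W) := by
    simp only [Matrix.mul_add, Matrix.add_mul, Matrix.mul_sub, Matrix.sub_mul, Matrix.mul_one,
      Matrix.one_mul, Matrix.mul_assoc]
    module
  have hannihilated : (Γ.mat * W * J * A.mat).trace = 0 := by
    rw [Matrix.trace_mul_comm]
    simp only [← Matrix.mul_assoc, hAΓ, Matrix.zero_mul, Matrix.trace_zero]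
  rw [SymMat.mat_neg, Matrix.neg_mul, Matrix.trace_neg, neg_nonneg, hfactor, hBW, hexpand, hΓA,
    hJAJ] at hcongr
  simp only [Matrix.zero_mul, add_zero, Matrix.trace_add, Matrix.trace_sub, Matrix.trace_smul,
    hannihilated, sub_zero, smul_eq_mul] at hcongr
  rw [SymMat.inner_eq_trace, sigmaTerm, cubicTerm]
  simp only [Matrix.mul_assoc] at hcongr ⊢
  linarith

theorem normalConeMonotoneAt_psdCone (A Γbar D : SymMat n) :
    NormalConeMonotoneAt (psdCone n) A Γbar D (-sigmaTerm A Γbar D) := by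
  intro c hc
  let lower (p : ℝ × SymMat n × SymMat n × SymMat n) : ℝ :=
    p.1 * cubicTerm A p.2.2.1 p.2.2.2 -
      (sigmaTerm A p.2.1 p.2.2.2 + sigmaTerm A p.2.2.1 p.2.2.2) / 2
  have hlower : Tendsto lower (𝓝[>] 0 ×ˢ 𝓝 Γbar ×ˢ 𝓝 Γbar ×ˢ 𝓝 D) (𝓝 (-sigmaTerm A Γbar D)) := by
    have hcont : Continuous lower := by
      have hcubic := continuous_cubicTerm A
      have hsigma := continuous_sigmaTerm A
      fun_prop
    have hval : lower (0, Γbar, Γbar, D) = -sigmaTerm A Γbar D := by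
      simp only [lower]; ring
    have hlim := hcont.tendsto (0, Γbar, Γbar, D)
    rw [hval, nhds_prod_eq, nhds_prod_eq, nhds_prod_eq] at hlim
    exact hlim.mono_left (prod_mono_left _ nhdsWithin_le_nhds)
  filter_upwards [hlower.eventually_const_lt hc, tendsto_fst.eventually self_mem_nhdsWithin]
    with ⟨t, Γ, Γ', H⟩ hlt (ht : 0 < t) hΓ hΓ'
  have hfar := inner_sub_eq_neg_sigmaTerm A hΓ
  have hnear := inner_sub_le_sigmaTerm_sub_cubicTerm hΓ' hΓ.1
  simp only [add_sub_cancel_left, real_inner_smul_right, sigmaTerm_smul, cubicTerm_smul]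
    at hfar hnear
  refine le_of_mul_le_mul_left ?_ ht
  calc t * (c * t) = t ^ 2 * c := by ring
    _ ≤ t ^ 2 * lower (t, Γ, Γ', H) := by gcongr
    _ ≤ t * inner ℝ Γ H - t * inner ℝ Γ' H := by simp only [lower]; linarith
    _ = t * inner ℝ (Γ - Γ') H := by rw [inner_sub_left]; ring

end PsdCone

section ZeroProd

variable {Y E : Type*} [NormedAddCommGroup Y] [InnerProductSpace ℝ Y]
  [NormedAddCommGroup E] [InnerProductSpace ℝ E] {S : Set E} {w l D : WithLp 2 (Y × E)}

/-- The product `{0} × S`, which turns an equality constraint and a constraint in `S` into a single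
constraint. -/
def zeroProd (Y : Type*) [NormedAddCommGroup Y] {E : Type*} (S : Set E) :
    Set (WithLp 2 (Y × E)) :=
  {w | w.fst = 0 ∧ w.snd ∈ S}

theorem mem_normalCone_zeroProd :
    l ∈ normalCone (zeroProd Y S) w ↔ w.fst = 0 ∧ l.snd ∈ normalCone S w.snd := by
  constructor
  · rintro ⟨⟨hw, hwS⟩, hl⟩
    refine ⟨hw, hwS, fun s hs => ?_⟩
    simpa [WithLp.prod_inner_apply, hw] using hl (WithLp.toLp 2 (0, s)) ⟨rfl, hs⟩
  · rintro ⟨hw, hwS, hl⟩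
    refine ⟨⟨hw, hwS⟩, fun w' hw' => ?_⟩
    simpa [WithLp.prod_inner_apply, hw, hw'.1] using hl w'.snd hw'.2

theorem fst_eq_zero_of_mem_tangentCone_zeroProd (hw : w.fst = 0)
    (hD : D ∈ tangentCone (zeroProd Y S) w) : D.fst = 0 := by
  obtain ⟨t, u, ht, -, hu, hmem⟩ := hD
  have hu_fst (k : ℕ) : (u k).fst = 0 := by
    simpa [hw, (ht k).ne'] using (hmem k).1
  have hlim : Tendsto (fun k => (u k).fst) atTop (𝓝 D.fst) :=
    ((WithLp.fstL 2 ℝ Y E).continuous.tendsto D).comp hu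
  simp only [hu_fst] at hlim
  exact tendsto_nhds_unique hlim tendsto_const_nhds

theorem snd_mem_tangentCone_of_mem_tangentCone_zeroProd
    (hD : D ∈ tangentCone (zeroProd Y S) w) : D.snd ∈ tangentCone S w.snd := by
  obtain ⟨t, u, ht, ht0, hu, hmem⟩ := hD
  exact ⟨t, fun k => (u k).snd, ht, ht0, ((WithLp.sndL 2 ℝ Y E).continuous.tendsto D).comp hu,
    fun k => (hmem k).2⟩

theorem criticalCone_zeroProd_subset (hw : w.fst = 0) (hD : D ∈ criticalCone (zeroProd Y S) w l) :
    D.fst = 0 ∧ D.snd ∈ criticalCone S w.snd l.snd := by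
  have hfst := fst_eq_zero_of_mem_tangentCone_zeroProd hw hD.1
  refine ⟨hfst, snd_mem_tangentCone_of_mem_tangentCone_zeroProd hD.1, ?_⟩
  simpa [WithLp.prod_inner_apply, hfst] using hD.2

theorem IsNormalConeCalm.zeroProd (hS : IsNormalConeCalm S w.snd) (hw : w.fst = 0) :
    IsNormalConeCalm (zeroProd Y S) w := by
  obtain ⟨C, hC⟩ := hS
  refine ⟨|C|, fun w' l hl => ?_⟩
  obtain ⟨s, hs, hls⟩ := hC w'.snd l.snd (mem_normalCone_zeroProd.1 hl).2
  refine ⟨WithLp.toLp 2 (l.fst, s), mem_normalCone_zeroProd.2 ⟨hw, hs⟩, ?_⟩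
  have hsub : l - WithLp.toLp 2 (l.fst, s) = WithLp.toLp 2 (0, l.snd - s) := by
    refine WithLp.ofLp_injective 2 (Prod.ext ?_ rfl)
    simp
  rw [hsub, WithLp.norm_toLp_snd]
  calc ‖l.snd - s‖ ≤ C * (‖l.snd‖ * ‖(w' - w).snd‖) := hls
    _ ≤ |C| * (‖l‖ * ‖w' - w‖) := by
      gcongr
      exacts [le_abs_self C, WithLp.norm_snd_le _ l, WithLp.norm_snd_le _ (w' - w)]

theorem NormalConeMonotoneAt.zeroProd {μ : ℝ}
    (hS : NormalConeMonotoneAt S w.snd l.snd D.snd μ) :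
    NormalConeMonotoneAt (zeroProd Y S) w l D μ := by
  intro c hc
  have hsnd (z : WithLp 2 (Y × E)) : Tendsto (fun z => z.snd) (𝓝 z) (𝓝 z.snd) :=
    (WithLp.sndL 2 ℝ Y E).continuous.tendsto z
  have hS' := (tendsto_id.prodMap ((hsnd l).prodMap ((hsnd l).prodMap (hsnd D)))).eventually
    (hS c hc)
  filter_upwards [hS', tendsto_fst.eventually self_mem_nhdsWithin]
    with ⟨t, m, m', H⟩ hmono (ht : 0 < t) hm hm'
  rw [mem_normalCone_zeroProd] at hm hm'
  have hH : H.fst = 0 := by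
    simpa [hm'.1, ht.ne'] using hm.1
  simpa [WithLp.prod_inner_apply, hH] using hmono hm.2 hm'.2

end ZeroProd

section ConstraintMap

variable {X Y E : Type*} [NormedAddCommGroup X] [InnerProductSpace ℝ X]
  [NormedAddCommGroup Y] [InnerProductSpace ℝ Y] [NormedAddCommGroup E] [InnerProductSpace ℝ E]
  {h : X → Y} {G : X → E} {x : X}

/-- The map `x ↦ (h x, G x)`, through which the constraints `h x = 0`, `G x ∈ S` read
`constraintMap h G x ∈ zeroProd Y S`. -/
def constraintMap (h : X → Y) (G : X → E) (x : X) : WithLp 2 (Y × E) :=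
  WithLp.toLp 2 (h x, G x)

theorem contDiffAt_constraintMap {k : WithTop ℕ∞} (hh : ContDiffAt ℝ k h x)
    (hG : ContDiffAt ℝ k G x) : ContDiffAt ℝ k (constraintMap h G) x :=
  (WithLp.contDiff_toLp (p := 2)).contDiffAt.comp x (hh.prodMk hG)

theorem fderiv_constraintMap_apply (hh : DifferentiableAt ℝ h x) (hG : DifferentiableAt ℝ G x)
    (d : X) : fderiv ℝ (constraintMap h G) x d =
      WithLp.toLp 2 (fderiv ℝ h x d, fderiv ℝ G x d) := by
  have hderiv := (WithLp.prodContinuousLinearEquiv 2 ℝ Y E).symm.hasFDerivAt.comp x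
    (hh.hasFDerivAt.prodMk hG.hasFDerivAt)
  exact congrArg (· d) hderiv.fderiv

theorem lagrangeGrad_constraintMap [CompleteSpace X] [CompleteSpace Y] [CompleteSpace E]
    (f : X → ℝ) (hh : DifferentiableAt ℝ h x) (hG : DifferentiableAt ℝ G x)
    (l : WithLp 2 (Y × E)) :
    lagrangeGrad f (constraintMap h G) x l =
      gradient f x + adjoint (fderiv ℝ h x) l.fst + adjoint (fderiv ℝ G x) l.snd := by
  rw [lagrangeGrad, add_assoc, add_right_inj]
  refine ext_inner_right ℝ fun d => ?_
  simp [adjoint_inner_left, inner_add_left, fderiv_constraintMap_apply hh hG,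
    WithLp.prod_inner_apply]

end ConstraintMap

theorem eventually_differentiableAt {X F : Type*} [NormedAddCommGroup X] [NormedSpace ℝ X]
    [NormedAddCommGroup F] [NormedSpace ℝ F] {g : X → F} {x : X} (hg : ContDiffAt ℝ 2 g x) :
    ∀ᶠ x' in 𝓝 x, DifferentiableAt ℝ g x' :=
  (hg.eventually (by simp)).mono fun _ hx' => hx'.differentiableAt two_ne_zero

theorem differentiableAt_gradient {X : Type*} [NormedAddCommGroup X] [InnerProductSpace ℝ X]
    [CompleteSpace X] {f : X → ℝ} {x : X} (hf : ContDiffAt ℝ 2 f x) :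
    DifferentiableAt ℝ (gradient f) x :=
  (InnerProductSpace.toDual ℝ X).symm.differentiableAt.comp x
    ((hf.fderiv_right (m := 1) (by norm_num)).differentiableAt (by norm_num))

theorem multG2_eq_normalCone {X Y : Type*} [NormedAddCommGroup Y] [InnerProductSpace ℝ Y] {n : ℕ}
    {h : X → Y} {G : X → SymMat n} {x : X} (hx : h x = 0) :
    multG2 Y G x = normalCone (zeroProd Y (psdCone n)) (constraintMap h G x) := by
  ext l
  simp [multG2, mem_normalCone_zeroProd, constraintMap, hx]

theorem triple_mem_kktSol {X Y : Type*} [NormedAddCommGroup X] [InnerProductSpace ℝ X]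
    [CompleteSpace X] [NormedAddCommGroup Y] [InnerProductSpace ℝ Y] {n : ℕ} {f : X → ℝ}
    {h : X → Y} {G : X → SymMat n} {a₁ x : X} {a₂ y : Y} {b Γ : SymMat n} :
    triple x y Γ ∈ kktSol f h G a₁ a₂ b ↔
      gradLagrangian f h G x y Γ = a₁ ∧ h x = a₂ ∧ Γ ∈ normalCone (psdCone n) (G x - b) := by
  rw [mem_normalCone_psdCone]
  constructor
  · rintro ⟨x', y', Γ', heq, hgrad, hfeas, hpsd, horth, hneg⟩
    obtain ⟨rfl, rfl, rfl⟩ : x = x' ∧ y = y' ∧ Γ = Γ' := by simpa [triple] using heq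
    exact ⟨sub_eq_zero.1 hgrad, sub_eq_zero.1 hfeas, hpsd, hneg, real_inner_comm Γ _ ▸ horth⟩
  · rintro ⟨hgrad, hfeas, hpsd, hneg, horth⟩
    exact ⟨x, y, Γ, rfl, sub_eq_zero.2 hgrad, sub_eq_zero.2 hfeas, hpsd,
      real_inner_comm Γ _ ▸ horth, hneg⟩

section Problem

variable {X Y : Type*} [NormedAddCommGroup X] [InnerProductSpace ℝ X] [CompleteSpace X]
  [NormedAddCommGroup Y] [InnerProductSpace ℝ Y] [CompleteSpace Y] {n : ℕ}
  {f : X → ℝ} {h : X → Y} {G : X → SymMat n} {x xbar : X}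

theorem gradLagrangian_eq_lagrangeGrad (hf : DifferentiableAt ℝ f x)
    (hh : DifferentiableAt ℝ h x) (hG : DifferentiableAt ℝ G x) (y : Y) (Γ : SymMat n) :
    gradLagrangian f h G x y Γ =
      lagrangeGrad f (constraintMap h G) x (WithLp.toLp 2 (y, Γ)) := by
  rw [lagrangeGrad_constraintMap f hh hG]
  refine HasGradientAt.gradient (hasGradientAt_iff_hasFDerivAt.2 ?_)
  refine ((hf.hasFDerivAt.add ((hasFDerivAt_const y x).inner ℝ hh.hasFDerivAt)).add
    ((hasFDerivAt_const Γ x).inner ℝ hG.hasFDerivAt)).congr_fderiv ?_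
  ext d
  simp [adjoint_inner_left]

theorem triple_mem_kktSol_iff_isKKT (hf : DifferentiableAt ℝ f x) (hh : DifferentiableAt ℝ h x)
    (hG : DifferentiableAt ℝ G x) {y a₂ : Y} {Γ b : SymMat n} {a₁ : X} :
    triple x y Γ ∈ kktSol f h G a₁ a₂ b ↔
      IsKKT f (constraintMap h G) (zeroProd Y (psdCone n)) a₁ (WithLp.toLp 2 (a₂, b)) x
        (WithLp.toLp 2 (y, Γ)) := by
  have hnormal : WithLp.toLp 2 (y, Γ) ∈ normalCone (zeroProd Y (psdCone n))
      (constraintMap h G x - WithLp.toLp 2 (a₂, b)) ↔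
        h x = a₂ ∧ Γ ∈ normalCone (psdCone n) (G x - b) := by
    rw [mem_normalCone_zeroProd, ← sub_eq_zero (a := h x)]
    rfl
  rw [triple_mem_kktSol, gradLagrangian_eq_lagrangeGrad hf hh hG, ← hnormal]
  exact ⟨fun hkkt => ⟨hkkt.1, hkkt.2⟩, fun hkkt => ⟨hkkt.1, hkkt.2⟩⟩

theorem eventually_isKKT_of_eventually_mem_kktSol {ι : Type*} {𝓕 : Filter ι}
    {z w : ι → Triple X Y n} (hf : ContDiffAt ℝ 2 f xbar) (hh : ContDiffAt ℝ 2 h xbar)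
    (hG : ContDiffAt ℝ 2 G xbar) (hz : Tendsto (fun i => (z i).fst) 𝓕 (𝓝 xbar))
    (hkkt : ∀ᶠ i in 𝓕, z i ∈ kktSol f h G (w i).fst (w i).snd.fst (w i).snd.snd) :
    ∀ᶠ i in 𝓕, IsKKT f (constraintMap h G) (zeroProd Y (psdCone n))
      (w i).fst (w i).snd (z i).fst (z i).snd := by
  filter_upwards [hz.eventually (eventually_differentiableAt hf),
    hz.eventually (eventually_differentiableAt hh), hz.eventually (eventually_differentiableAt hG),
    hkkt] with i hfz hhz hGz hmem
  exact (triple_mem_kktSol_iff_isKKT hfz hhz hGz).1 hmem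

theorem multipliers_eq_setOf_isKKT (hf : DifferentiableAt ℝ f x) (hh : DifferentiableAt ℝ h x)
    (hG : DifferentiableAt ℝ G x) :
    multipliers f h G x =
      {l | IsKKT f (constraintMap h G) (zeroProd Y (psdCone n)) 0 0 x l} :=
  Set.ext fun l => triple_mem_kktSol_iff_isKKT (y := l.fst) (Γ := l.snd) hf hh hG

theorem multG1_eq_setOf_lagrangeGrad_eq_zero (f : X → ℝ) (hh : DifferentiableAt ℝ h x)
    (hG : DifferentiableAt ℝ G x) :
    multG1 f h G x = {l | lagrangeGrad f (constraintMap h G) x l = 0} := by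
  simp only [lagrangeGrad_constraintMap f hh hG, multG1]

theorem hessLagrangian_eq_fderiv_lagrangeGrad (hf : ContDiffAt ℝ 2 f xbar)
    (hh : ContDiffAt ℝ 2 h xbar) (hG : ContDiffAt ℝ 2 G xbar) (y : Y) (Γ : SymMat n) :
    hessLagrangian f h G xbar y Γ =
      fderiv ℝ (fun x => lagrangeGrad f (constraintMap h G) x (WithLp.toLp 2 (y, Γ))) xbar := by
  refine EventuallyEq.fderiv_eq ?_
  filter_upwards [eventually_differentiableAt hf, eventually_differentiableAt hh,
    eventually_differentiableAt hG] with x hfx hhx hGx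
  exact gradLagrangian_eq_lagrangeGrad hfx hhx hGx y Γ

theorem secondOrderSufficient_of_SOSC (hf : ContDiffAt ℝ 2 f xbar) (hh : ContDiffAt ℝ 2 h xbar)
    (hG : ContDiffAt ℝ 2 G xbar) (hfeas : h xbar = 0) {ybar : Y} {Γbar : SymMat n}
    (hSOSC : SOSC f h G xbar ybar Γbar) :
    SecondOrderSufficient f (constraintMap h G) (zeroProd Y (psdCone n)) xbar
      (WithLp.toLp 2 (ybar, Γbar)) := by
  intro d hd hcrit
  have hD := fderiv_constraintMap_apply (hh.differentiableAt two_ne_zero)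
    (hG.differentiableAt two_ne_zero) d
  have hcone := criticalCone_zeroProd_subset (w := constraintMap h G xbar) hfeas hcrit
  rw [hD] at hcone
  refine ⟨-sigmaTerm (G xbar) Γbar (fderiv ℝ G xbar d), ?_, ?_⟩
  · rw [hD]
    exact NormalConeMonotoneAt.zeroProd (normalConeMonotoneAt_psdCone _ _ _)
  · rw [← hessLagrangian_eq_fderiv_lagrangeGrad hf hh hG, ← sub_eq_add_neg]
    exact hSOSC d hcone hd

theorem norm_sub_add_infDist_multipliers_isBigO [FiniteDimensional ℝ X] {ι : Type*}
    {𝓕 : Filter ι} [𝓕.IsCountablyGenerated] {z w : ι → Triple X Y n} {ybar : Y} {Γbar : SymMat n}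
    (hf : ContDiffAt ℝ 2 f xbar) (hh : ContDiffAt ℝ 2 h xbar) (hG : ContDiffAt ℝ 2 G xbar)
    (hM : WithLp.toLp 2 (ybar, Γbar) ∈ multipliers f h G xbar)
    (hSOSC : SOSC f h G xbar ybar Γbar)
    (hri : (multG1 f h G xbar ∩ intrinsicInterior ℝ (multG2 Y G xbar)).Nonempty)
    (hz : Tendsto z 𝓕 (𝓝 (triple xbar ybar Γbar))) (hw : Tendsto w 𝓕 (𝓝 (triple 0 0 0)))
    (hkkt : ∀ᶠ i in 𝓕, z i ∈ kktSol f h G (w i).fst (w i).snd.fst (w i).snd.snd) :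
    (fun i => ‖(z i).fst - xbar‖ + Metric.infDist (z i).snd (multipliers f h G xbar)) =O[𝓕] w := by
  have hf1 := hf.differentiableAt two_ne_zero
  have hh1 := hh.differentiableAt two_ne_zero
  have hG1 := hG.differentiableAt two_ne_zero
  have hg := contDiffAt_constraintMap hh hG
  obtain ⟨-, hfeas, hΓbar⟩ := triple_mem_kktSol.1 hM
  rw [multG1_eq_setOf_lagrangeGrad_eq_zero f hh1 hG1, multG2_eq_normalCone hfeas] at hri
  obtain ⟨v, hv0, hv⟩ := hri
  rw [multipliers_eq_setOf_isKKT hf1 hh1 hG1] at hM ⊢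
  have hcalm : IsNormalConeCalm (zeroProd Y (psdCone n)) (constraintMap h G xbar) := by
    rw [sub_zero] at hΓbar
    exact IsNormalConeCalm.zeroProd (isNormalConeCalm_psdCone hΓbar.1) hfeas
  have hlbar : WithLp.toLp 2 (ybar, Γbar) ∈
      normalCone (zeroProd Y (psdCone n)) (constraintMap h G xbar) := by
    simpa using hM.mem_normalCone
  have hg' := (hg.fderiv_right (m := 1) (by norm_num)).differentiableAt one_ne_zero
  have hx : Tendsto (fun i => (z i).fst) 𝓕 (𝓝 xbar) :=
    ((WithLp.fstL 2 ℝ X (Mult Y n)).continuous.tendsto _).comp hz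
  have hsnd := (WithLp.sndL 2 ℝ X (Mult Y n)).continuous.tendsto
  have hbound := norm_sub_add_infDist_isBigO (differentiableAt_gradient hf)
    (hg.differentiableAt two_ne_zero) hg' hcalm hlbar
    (secondOrderSufficient_of_SOSC hf hh hG hfeas hSOSC) hv hv0 hx ((hsnd _).comp hz)
    ((hsnd _).comp hw) (eventually_isKKT_of_eventually_mem_kktSol hf hh hG hx hkkt)
  have hw_fst : (fun i => (w i).fst) =O[𝓕] w := isBigO_of_le 𝓕 fun i => WithLp.norm_fst_le _ (w i)
  have hw_snd : (fun i => (w i).snd) =O[𝓕] w := isBigO_of_le 𝓕 fun i => WithLp.norm_snd_le _ (w i)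
  exact hbound.trans (hw_fst.norm_left.add hw_snd.norm_left)

end Problem

theorem exists_ball_isOpen_of_isBigO {P W : Type*} [PseudoMetricSpace P]
    [SeminormedAddCommGroup W] {S : Set (P × W)} {pbar : P} {wbar : W} {e : P → ℝ}
    (h : (fun z : P × W => e z.1) =O[𝓝 (pbar, wbar) ⊓ 𝓟 S] fun z => z.2) :
    ∃ κ : ℝ, 0 < κ ∧ ∃ r : ℝ, 0 < r ∧ ∃ U : Set W, IsOpen U ∧ wbar ∈ U ∧
      ∀ w ∈ U, ∀ p ∈ Metric.ball pbar r, (p, w) ∈ S → ‖e p‖ ≤ κ * ‖w‖ := by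
  obtain ⟨κ, hκ, hbound⟩ := h.exists_pos
  rw [isBigOWith_iff, eventually_inf_principal, nhds_prod_eq, eventually_prod_iff] at hbound
  obtain ⟨nearP, hnearP, nearW, hnearW, hbound⟩ := hbound
  obtain ⟨r, hr, hball⟩ := Metric.eventually_nhds_iff_ball.1 hnearP
  obtain ⟨U, hU, hU_open, hwbar⟩ := eventually_nhds_iff.1 hnearW
  exact ⟨κ, hκ, r, hr, U, hU_open, hwbar, fun w hw p hp hmem => hbound (hball p hp) (hU w hw) hmem⟩

end NLSDP

open NLSDP in
theorem mainTheorem3_general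
    {X : Type*} [NormedAddCommGroup X] [InnerProductSpace ℝ X] [FiniteDimensional ℝ X]
    [CompleteSpace X]
    {Y : Type*} [NormedAddCommGroup Y] [InnerProductSpace ℝ Y] [CompleteSpace Y]
    {n : ℕ} {f : X → ℝ} {h : X → Y} {G : X → SymMat n} {xbar : X} {ybar : Y} {Γbar : SymMat n}
    (hf : ContDiffAt ℝ 2 f xbar) (hh : ContDiffAt ℝ 2 h xbar) (hG : ContDiffAt ℝ 2 G xbar)
    (hM : WithLp.toLp 2 (ybar, Γbar) ∈ multipliers f h G xbar)
    (hSOSC : SOSC f h G xbar ybar Γbar)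
    (hri : (multG1 f h G xbar ∩ intrinsicInterior ℝ (multG2 Y G xbar)).Nonempty) :
    ∃ κ₁ : ℝ, 0 < κ₁ ∧ ∃ r₁ : ℝ, 0 < r₁ ∧
      ∃ U : Set (Triple X Y n), IsOpen U ∧ triple 0 0 0 ∈ U ∧
        ∀ (a₁ : X) (a₂ : Y) (b : SymMat n), triple a₁ a₂ b ∈ U →
          ∀ (x : X) (y : Y) (Γ : SymMat n), triple x y Γ ∈ kktSol f h G a₁ a₂ b →
            triple x y Γ ∈ Metric.ball (triple xbar ybar Γbar) r₁ →
            ‖x - xbar‖ + Metric.infDist (WithLp.toLp 2 (y, Γ)) (multipliers f h G xbar) ≤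
              κ₁ * ‖triple a₁ a₂ b‖ := by
  let residual (z : Triple X Y n) : ℝ :=
    ‖z.fst - xbar‖ + Metric.infDist z.snd (multipliers f h G xbar)
  let S : Set (Triple X Y n × Triple X Y n) :=
    {p | p.1 ∈ kktSol f h G p.2.fst p.2.snd.fst p.2.snd.snd}
  let 𝓕 := 𝓝 (triple xbar ybar Γbar, triple 0 0 0) ⊓ 𝓟 S
  have hz : Tendsto Prod.fst 𝓕 (𝓝 (triple xbar ybar Γbar)) :=
    continuousAt_fst.tendsto.mono_left inf_le_left
  have hw : Tendsto Prod.snd 𝓕 (𝓝 (triple 0 0 0)) :=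
    continuousAt_snd.tendsto.mono_left inf_le_left
  have hbigO : (fun p => residual p.1) =O[𝓕] Prod.snd :=
    norm_sub_add_infDist_multipliers_isBigO hf hh hG hM hSOSC hri hz hw
      (mem_inf_of_right (mem_principal_self S))
  obtain ⟨κ, hκ, r, hr, U, hU, hU_zero, hbound⟩ := exists_ball_isOpen_of_isBigO hbigO
  refine ⟨κ, hκ, r, hr, U, hU, hU_zero, fun a₁ a₂ b hab x y Γ hkkt hball => ?_⟩
  exact (Real.le_norm_self (residual (triple x y Γ))).trans (hbound _ hab _ hball hkkt)

theorem mainTheorem3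
    {X : Type*} [NormedAddCommGroup X] [InnerProductSpace ℝ X] [FiniteDimensional ℝ X]
    [CompleteSpace X]
    {Y : Type*} [NormedAddCommGroup Y] [InnerProductSpace ℝ Y] [FiniteDimensional ℝ Y]
    [CompleteSpace Y]
    {n : ℕ} (f : X → ℝ) (h : X → Y) (G : X → NLSDP.SymMat n)
    (hf : ContDiff ℝ 2 f) (hh : ContDiff ℝ 2 h) (hG : ContDiff ℝ 2 G)
    (xbar : X) (hx : NLSDP.IsStationary f h G xbar)
    (ybar : Y) (Γbar : NLSDP.SymMat n)
    (hM : WithLp.toLp 2 (ybar, Γbar) ∈ NLSDP.multipliers f h G xbar)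
    (hSOSC : NLSDP.SOSC f h G xbar ybar Γbar)
    (hri : (NLSDP.multG1 f h G xbar ∩ intrinsicInterior ℝ (NLSDP.multG2 Y G xbar)).Nonempty) :
    ∃ κ₁ : ℝ, 0 < κ₁ ∧ ∃ r₁ : ℝ, 0 < r₁ ∧
      ∃ U : Set (NLSDP.Triple X Y n), IsOpen U ∧ NLSDP.triple 0 0 0 ∈ U ∧
        ∀ (a₁ : X) (a₂ : Y) (b : NLSDP.SymMat n), NLSDP.triple a₁ a₂ b ∈ U →
          ∀ (x : X) (y : Y) (Γ : NLSDP.SymMat n),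
            NLSDP.triple x y Γ ∈ NLSDP.kktSol f h G a₁ a₂ b →
            NLSDP.triple x y Γ ∈ Metric.ball (NLSDP.triple xbar ybar Γbar) r₁ →
            ‖x - xbar‖ +
                Metric.infDist (WithLp.toLp 2 (y, Γ)) (NLSDP.multipliers f h G xbar) ≤
              κ₁ * ‖NLSDP.triple a₁ a₂ b‖ :=
  mainTheorem3_general hf.contDiffAt hh.contDiffAt hG.contDiffAt hM hSOSC hri
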